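/- Let $n\ge 0$ and let $\mu$ be a probability measure on the subsets of $[n]=\{1,\dots,n\}$ with generating polynomial $P_\mu(z_1,\dots,z_n)=\sum_{S\subseteq[n]}\mu(S)\prod_{i\in S}z_i$. Assume that $\mu$ is homogeneous (that is, $P_\mu$ is a homogeneous polynomial) and Strongly Rayleigh (that is, $P_\mu(z_1,\dots,z_n)\neq 0$ whenever $\operatorname{Im} z_i>0$ for all $i\in[n]$), and that all its marginal probabilities satisfy $\mathbb{P}_{S\sim\mu}[i\in S]\le\epsilon$ for $i\in[n]$. Let $A\in M_n(\mathbb{C})$ be a positive semidefinite matrix with operator norm $\|A\|\le 1$ whose diagonal entries are all at most $\alpha$. For $S\subseteq[n]$ let $A(S)$ be the principal submatrix of $A$ with rows and columns indexed by $S$, and let $\lambda_{\max}A(S)$ be its largest eigenvalue (with $\lambda_{\max}A(\emptyset)=-\infty$). If $\sqrt{\alpha}+\sqrt{\epsilon}\le 1$, then \[\mathbb{P}_{S\sim\mu}\left[\lambda_{\max}A(S)<4\epsilon^{1/4}+\alpha\right]>0.\] -/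

import Mathlib

open scoped ComplexOrder

noncomputable section

/-- A polynomial with real coefficients is real stable if it does not vanish when all the
variables lie in the open upper half plane. -/
def RealStable {σ : Type*} (p : MvPolynomial σ ℝ) : Prop :=
  ∀ z : σ → ℂ, (∀ i, 0 < (z i).im) → MvPolynomial.aeval z p ≠ 0

/-- The generating polynomial `∑ S, μ(S) z^S` of a probability measure on the subsets of `[n]`. -/
def generatingPoly {n : ℕ} (μ : PMF (Finset (Fin n))) : MvPolynomial (Fin n) ℝ :=
  ∑ S : Finset (Fin n), MvPolynomial.C (μ S).toReal * ∏ i ∈ S, MvPolynomial.X i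

/-- A probability measure on the subsets of `[n]` is strongly Rayleigh if its generating
polynomial is real stable. -/
def IsStronglyRayleigh {n : ℕ} (μ : PMF (Finset (Fin n))) : Prop :=
  RealStable (generatingPoly μ)

/-- A probability measure on the subsets of `[n]` is homogeneous if its generating polynomial
is homogeneous (of some degree). -/
def IsHomogeneousMeasure {n : ℕ} (μ : PMF (Finset (Fin n))) : Prop :=
  ∃ d : ℕ, (generatingPoly μ).IsHomogeneous d

/-- The probability of an event under a probability measure on the subsets of `[n]`. -/
def prob {n : ℕ} (μ : PMF (Finset (Fin n))) (E : Set (Finset (Fin n))) : ℝ :=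
  (μ.toOuterMeasure E).toReal

/-- The marginal probability of `i`: the probability that `i` belongs to the random set. -/
def marginal {n : ℕ} (μ : PMF (Finset (Fin n))) (i : Fin n) : ℝ :=
  prob μ {S | i ∈ S}

/-- A complex matrix is a contraction if its operator norm on Euclidean space is at most one. -/
def IsMatrixContraction {n : ℕ} (A : Matrix (Fin n) (Fin n) ℂ) : Prop :=
  ‖Matrix.toEuclideanCLM (n := Fin n) (𝕜 := ℂ) A‖ ≤ 1

/-- The principal submatrix `A(S)`, with rows and columns indexed by `S`. -/
def principalSubmatrix {n : ℕ} (A : Matrix (Fin n) (Fin n) ℂ) (S : Finset (Fin n)) :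
    Matrix S S ℂ :=
  A.submatrix Subtype.val Subtype.val

/-- The largest eigenvalue of a hermitian matrix, as an extended real number; the empty matrix
has no eigenvalue, and the value there is `-∞`. -/
def lambdaMax {ι : Type*} [Fintype ι] [DecidableEq ι] (M : Matrix ι ι ℂ) : EReal :=
  ⨆ r ∈ spectrum ℝ M, (r : EReal)

end

/-!
The mixture `∑ S, μ(S) det (x - A(S))` of characteristic polynomials is the value on the line
`z_i + w_i = x` of the function obtained from `det (diag(z) - A) * P_μ(w)` by applying
`∂/∂z_i + ∂/∂w_i` for every `i`. These operators preserve stability, so the mixture is real-rooted,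
and so are the mixtures of the measures obtained by conditioning on `i ∈ S` and on `i ∉ S`, together
with all their nonnegative combinations. Hence the conditioned mixtures interlace, and deciding the
elements one at a time leads to a set `S` in the support of `μ` such that the largest root of
`det (x - A(S))` is at most that of the mixture.

The largest root of the mixture is bounded by a multivariate barrier argument. The Rayleigh
inequalities of a stable function say that its logarithmic derivatives decrease in every variable;
if those in `z_i` and `w_i` are at most `a` and `b`, then after applying `∂/∂z_i + ∂/∂w_i` the
barrier condition for the other variables still holds with the `i`-th variable moved down by
`1 / (a + b)`. For `det (diag(z) - A)` the logarithmic derivatives are diagonal entries of the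
resolvent of `A`, bounded through `α` because `0 ≤ A ≤ 1`; for `P_μ` they are bounded through the
marginals.
-/

/-! ### Multi-affine functions -/

section MultiAffine

variable {ι R : Type*} [DecidableEq ι] [CommRing R]

/-- The slope of a function in its `i`-th variable, as a linear operator. On functions affine in
that variable it is the partial derivative. -/
def slopeIn (i : ι) : Module.End R ((ι → R) → R) where
  toFun f x := f (Function.update x i 1) - f (Function.update x i 0)
  map_add' f g := by funext x; simp only [Pi.add_apply]; ring
  map_smul' c f := by funext x; simp only [Pi.smul_apply, smul_eq_mul, RingHom.id_apply]; ring

theorem slopeIn_apply (i : ι) (f : (ι → R) → R) (x : ι → R) :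
    slopeIn i f x = f (Function.update x i 1) - f (Function.update x i 0) :=
  rfl

theorem slopeIn_comm (i j : ι) (f : (ι → R) → R) :
    slopeIn i (slopeIn j f) = slopeIn j (slopeIn i f) := by
  rcases eq_or_ne i j with rfl | h
  · rfl
  funext x
  simp only [slopeIn_apply, Function.update_comm h]
  ring

theorem commute_slopeIn (i j : ι) : Commute (slopeIn (R := R) i) (slopeIn j) :=
  LinearMap.ext fun f => slopeIn_comm i j f

theorem slopeIn_update (i : ι) (f : (ι → R) → R) (x : ι → R) (t : R) :
    slopeIn i f (Function.update x i t) = slopeIn i f x := by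
  simp only [slopeIn_apply, Function.update_idem]

theorem slopeIn_slopeIn_self (i : ι) (f : (ι → R) → R) : slopeIn i (slopeIn i f) = 0 := by
  funext x
  rw [slopeIn_apply, slopeIn_update, slopeIn_update, sub_self, Pi.zero_apply]

/-- The slope in all the variables of a finite set. -/
def slopesIn (T : Finset ι) : Module.End R ((ι → R) → R) :=
  T.noncommProd slopeIn fun i _ j _ _ => commute_slopeIn i j

theorem slopesIn_empty (f : (ι → R) → R) : slopesIn ∅ f = f :=
  DFunLike.congr_fun (Finset.noncommProd_empty slopeIn _) f

theorem slopesIn_insert {i : ι} {T : Finset ι} (hi : i ∉ T) (f : (ι → R) → R) :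
    slopesIn (insert i T) f = slopesIn T (slopeIn i f) :=
  DFunLike.congr_fun (Finset.noncommProd_insert_of_notMem' T i slopeIn _ hi) f

theorem slopesIn_insert' {i : ι} {T : Finset ι} (hi : i ∉ T) (f : (ι → R) → R) :
    slopesIn (insert i T) f = slopeIn i (slopesIn T f) :=
  DFunLike.congr_fun (Finset.noncommProd_insert_of_notMem T i slopeIn _ hi) f

/-- A function that is affine in each variable separately. -/
def MultiAffine (f : (ι → R) → R) : Prop :=
  ∀ i x t, f (Function.update x i t) = f (Function.update x i 0) + t * slopeIn i f x

namespace MultiAffine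

variable {f g : (ι → R) → R}

protected theorem add (hf : MultiAffine f) (hg : MultiAffine g) : MultiAffine (f + g) := by
  intro i x t
  simp only [map_add, Pi.add_apply, hf i x t, hg i x t]
  ring

protected theorem neg (hf : MultiAffine f) : MultiAffine (-f) := by
  intro i x t
  simp only [map_neg, Pi.neg_apply, hf i x t]
  ring

protected theorem slopeIn (hf : MultiAffine f) (i : ι) : MultiAffine (slopeIn i f) := by
  intro j x t
  rcases eq_or_ne i j with rfl | h
  · simp only [slopeIn_update, slopeIn_slopeIn_self, Pi.zero_apply, mul_zero, add_zero]
  · have h1 := hf j (Function.update x i 1) t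
    have h0 := hf j (Function.update x i 0) t
    simp only [slopeIn_apply, Function.update_comm h] at h1 h0 ⊢
    rw [h1, h0]
    ring

protected theorem slopesIn (hf : MultiAffine f) (T : Finset ι) : MultiAffine (slopesIn T f) := by
  induction T using Finset.induction_on with
  | empty => rwa [slopesIn_empty]
  | insert i T hi ih =>
    rw [slopesIn_insert' hi]
    exact ih.slopeIn i

theorem apply_update (hf : MultiAffine f) (i : ι) (x : ι → R) (t : R) :
    f (Function.update x i t) = f x + (t - x i) * slopeIn i f x := by
  have hx := hf i x (x i)
  rw [Function.update_eq_self] at hx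
  rw [hf i x t, hx]
  ring

theorem apply_update_add (hf : MultiAffine f) (i : ι) (x : ι → R) (t : R) :
    f (Function.update x i (x i + t)) = f x + t * slopeIn i f x := by
  rw [hf.apply_update, add_sub_cancel_left]

theorem comp_update (hf : MultiAffine f) (i : ι) (t : R) :
    MultiAffine fun x => f (Function.update x i t) := by
  intro j x s
  rcases eq_or_ne i j with rfl | h
  · simp [slopeIn_apply]
  · have hj := hf j (Function.update x i t) s
    simp only [slopeIn_apply, Function.update_comm h] at hj ⊢
    exact hj

protected theorem continuous [Finite ι] [TopologicalSpace R] [IsTopologicalRing R]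
    (hf : MultiAffine f) : Continuous f := by
  cases nonempty_fintype ι
  suffices h : ∀ T : Finset ι, ∀ f : (ι → R) → R, MultiAffine f →
      Continuous fun x => f (T.piecewise x 0) by
    simpa using h Finset.univ f hf
  intro T
  induction T using Finset.induction_on with
  | empty => exact fun f _ => by simpa using continuous_const
  | insert i T hi ih =>
    intro f hf
    simp only [Finset.piecewise_insert, hf.apply_update,
      Finset.piecewise_eq_of_notMem _ _ _ hi, Pi.zero_apply, sub_zero]
    exact (ih f hf).add ((continuous_apply i).mul (ih _ (hf.slopeIn i)))

theorem eq_zero_of_forall_mem_pi [Finite ι] [IsDomain R] (hf : MultiAffine f) {s : ι → Set R}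
    (hs : ∀ i, (s i).Nontrivial) (h : ∀ x ∈ Set.univ.pi s, f x = 0) : f = 0 := by
  cases nonempty_fintype ι
  suffices H : ∀ T : Finset ι, ∀ x : ι → R, (∀ i ∉ T, x i ∈ s i) → f x = 0 from
    funext fun x => H Finset.univ x fun i hi => absurd (Finset.mem_univ i) hi
  intro T
  induction T using Finset.induction_on with
  | empty => exact fun x hx => h x fun i _ => hx i (Finset.notMem_empty i)
  | insert i T hi ih =>
    intro x hx
    have hvanish (a : R) (ha : a ∈ s i) : f x + (a - x i) * slopeIn i f x = 0 := by
      rw [← hf.apply_update]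
      refine ih _ fun j hj => ?_
      rcases eq_or_ne j i with rfl | hji
      · rwa [Function.update_self]
      · rw [Function.update_of_ne hji]
        exact hx j (by simp [hji, hj])
    obtain ⟨a, ha, b, hb, hab⟩ := hs i
    have hslope : slopeIn i f x = 0 := by
      refine (mul_eq_zero.1 ?_).resolve_left (sub_ne_zero.2 hab)
      linear_combination hvanish a ha - hvanish b hb
    simpa [hslope] using hvanish a ha

end MultiAffine

end MultiAffine

/-! ### Stability -/

section Stability

open ComplexConjugate Filter Topology

variable {ι : Type*} [DecidableEq ι] {f g : (ι → ℂ) → ℂ}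

/-- Stability of a multi-affine function: it has no zero in the product of the open upper half
planes. -/
def NonvanishingOnUpper (f : (ι → ℂ) → ℂ) : Prop :=
  ∀ x : ι → ℂ, (∀ i, 0 < (x i).im) → f x ≠ 0

theorem upper_update {x : ι → ℂ} (hx : ∀ i, 0 < (x i).im) (i : ι) {t : ℂ} (ht : 0 < t.im)
    (j : ι) : 0 < (Function.update x i t j).im := by
  rcases eq_or_ne j i with rfl | hji
  · rwa [Function.update_self]
  · rw [Function.update_of_ne hji]
    exact hx j

theorem tendsto_apply_add_mul_I [Finite ι] (hf : MultiAffine f) (x : ι → ℂ) :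
    Tendsto (fun η : ℝ => f fun i => x i + η * Complex.I) (𝓝[>] 0) (𝓝 (f x)) := by
  have hcont : Continuous fun η : ℝ => f fun i => x i + η * Complex.I :=
    hf.continuous.comp (by fun_prop)
  simpa using (hcont.tendsto 0).mono_left nhdsWithin_le_nhds

/-- If the inequality `Im (g * conj k) ≤ 0` survives at a zero of `g`, then moving the `j`-th
variable by `η I k / slopeIn j g` violates it to first order in `η` unless `slopeIn j g` is also
zero there. -/
theorem slopeIn_eq_zero_of_im_mul_conj_nonpos {k : (ι → ℂ) → ℂ} (hg : MultiAffine g)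
    (hk : MultiAffine k) (hle : ∀ x : ι → ℂ, (∀ i, 0 < (x i).im) → (g x * conj (k x)).im ≤ 0)
    {x : ι → ℂ} (hx : ∀ i, 0 < (x i).im) (hgx : g x = 0) (hkx : k x ≠ 0) (j : ι) :
    slopeIn j g x = 0 := by
  by_contra ha
  set a := slopeIn j g x
  set c := slopeIn j k x
  set t : ℂ := Complex.I * (k x / a)
  have hta : t * a = Complex.I * k x := by
    rw [mul_assoc, div_mul_cancel₀ _ ha]
  have him (η : ℝ) : (η * t * a * conj (k x + η * t * c)).im =
      η * (Complex.normSq (k x) + η * (t * a * conj (t * c)).im) := by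
    have hsplit : η * t * a * conj (k x + η * t * c) =
        η * (Complex.I * Complex.normSq (k x) + η * (t * a * conj (t * c))) := by
      simp only [map_add, map_mul, Complex.conj_ofReal, ← Complex.mul_conj]
      linear_combination η * conj (k x) * hta
    rw [hsplit, Complex.im_ofReal_mul, Complex.add_im, Complex.im_ofReal_mul,
      Complex.im_mul_ofReal, Complex.I_im, one_mul]
  have hnonpos : ∀ᶠ η : ℝ in 𝓝[>] 0,
      Complex.normSq (k x) + η * (t * a * conj (t * c)).im ≤ 0 := by
    have hmove : Tendsto (fun η : ℝ => (x j + η * t).im) (𝓝[>] 0) (𝓝 (x j).im) := by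
      have hcont : Continuous fun η : ℝ => (x j + η * t).im := by fun_prop
      simpa using (hcont.tendsto 0).mono_left nhdsWithin_le_nhds
    filter_upwards [hmove.eventually_const_lt (hx j), self_mem_nhdsWithin] with η hη hηpos
    have hineq := hle _ (upper_update hx j hη)
    rw [hg.apply_update_add, hk.apply_update_add, hgx, zero_add, him] at hineq
    exact nonpos_of_mul_nonpos_right hineq hηpos
  have hlim : Tendsto (fun η : ℝ => Complex.normSq (k x) + η * (t * a * conj (t * c)).im)
      (𝓝[>] 0) (𝓝 (Complex.normSq (k x))) := by
    have hcont : Continuous fun η : ℝ =>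
      Complex.normSq (k x) + η * (t * a * conj (t * c)).im := by fun_prop
    simpa using (hcont.tendsto 0).mono_left nhdsWithin_le_nhds
  exact (Complex.normSq_pos.2 hkx).not_ge (le_of_tendsto hlim hnonpos)

theorem eq_zero_of_slopeIn_eq_zero [Finite ι] (hg : MultiAffine g)
    (hslope : ∀ x : ι → ℂ, (∀ i, 0 < (x i).im) → g x = 0 → ∀ j, slopeIn j g x = 0)
    {x : ι → ℂ} (hx : ∀ i, 0 < (x i).im) (hgx : g x = 0) : g = 0 := by
  cases nonempty_fintype ι
  refine hg.eq_zero_of_forall_mem_pi (s := fun _ => {z : ℂ | 0 < z.im})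
    (fun _ => ⟨Complex.I, by simp, 2 * Complex.I, by simp, by norm_num⟩) fun y hy => ?_
  replace hy : ∀ i, 0 < (y i).im := fun i => hy i trivial
  suffices H : ∀ T : Finset ι,
      (∀ i, 0 < (T.piecewise y x i).im) ∧ g (T.piecewise y x) = 0 by
    simpa using (H Finset.univ).2
  intro T
  induction T using Finset.induction_on with
  | empty => simpa using ⟨hx, hgx⟩
  | insert i T _ ih =>
    rw [Finset.piecewise_insert]
    refine ⟨upper_update ih.1 i (hy i), ?_⟩
    rw [hg.apply_update, ih.2, hslope _ ih.1 ih.2 i, mul_zero, add_zero]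

theorem nonvanishingOnUpper_of_im_mul_conj_nonpos [Finite ι] {k : (ι → ℂ) → ℂ}
    (hg : MultiAffine g) (hk : MultiAffine k) (hg0 : g ≠ 0)
    (hle : ∀ x : ι → ℂ, (∀ i, 0 < (x i).im) → (g x * conj (k x)).im ≤ 0)
    (hne : ∀ x : ι → ℂ, (∀ i, 0 < (x i).im) → g x = 0 → k x ≠ 0) : NonvanishingOnUpper g :=
  fun _ hx hgx => hg0 <| eq_zero_of_slopeIn_eq_zero hg
    (fun y hy hgy => slopeIn_eq_zero_of_im_mul_conj_nonpos hg hk hle hy hgy (hne y hy hgy)) hx hgx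

namespace NonvanishingOnUpper

theorem im_slopeIn_mul_conj_neg (hs : NonvanishingOnUpper f) (hf : MultiAffine f) {x : ι → ℂ}
    (hx : ∀ k, 0 < (x k).im) {i : ι} (hi : slopeIn i f x ≠ 0) :
    (slopeIn i f x * conj (f x)).im < 0 := by
  have hroot : f (Function.update x i (x i + -(f x / slopeIn i f x))) = 0 := by
    rw [hf.apply_update_add, neg_mul, div_mul_cancel₀ _ hi, add_neg_cancel]
  have him : 0 < (f x / slopeIn i f x).im := by
    by_contra! h
    refine hs _ (upper_update hx i ?_) hroot
    rw [Complex.add_im, Complex.neg_im]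
    linarith [hx i]
  have hconj : slopeIn i f x * conj (f x) =
      (Complex.normSq (slopeIn i f x) : ℂ) * conj (f x / slopeIn i f x) := by
    have hi' : conj (slopeIn i f x) ≠ 0 := (map_ne_zero _).2 hi
    rw [← Complex.mul_conj, map_div₀]
    field_simp
  rw [hconj, Complex.im_ofReal_mul, Complex.conj_im, mul_neg, neg_lt_zero]
  exact mul_pos (Complex.normSq_pos.2 hi) him

theorem im_slopeIn_mul_conj_nonpos [Finite ι] (hs : NonvanishingOnUpper f) (hf : MultiAffine f)
    {x : ι → ℂ} (hx : ∀ k, 0 ≤ (x k).im) (i : ι) : (slopeIn i f x * conj (f x)).im ≤ 0 := by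
  have hlim := (tendsto_apply_add_mul_I (hf.slopeIn i) x).mul
    ((Complex.continuous_conj.tendsto _).comp (tendsto_apply_add_mul_I hf x))
  refine le_of_tendsto ((Complex.continuous_im.tendsto _).comp hlim) ?_
  filter_upwards [self_mem_nhdsWithin] with η hη
  have hup (k : ι) : 0 < (x k + η * Complex.I).im := by
    simpa using add_pos_of_nonneg_of_pos (hx k) hη
  by_cases h : slopeIn i f (fun k => x k + η * Complex.I) = 0
  · simp [h]
  · exact (hs.im_slopeIn_mul_conj_neg hf hup h).le

protected theorem slopeIn [Finite ι] (hs : NonvanishingOnUpper f) (hf : MultiAffine f) {i : ι}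
    (hi : slopeIn i f ≠ 0) : NonvanishingOnUpper (slopeIn i f) :=
  nonvanishingOnUpper_of_im_mul_conj_nonpos (hf.slopeIn i) hf hi
    (fun _ hx => hs.im_slopeIn_mul_conj_nonpos hf (fun k => (hx k).le) i) fun x hx _ => hs x hx

theorem update_zero [Finite ι] (hs : NonvanishingOnUpper f) (hf : MultiAffine f) {i : ι}
    (hi : (fun x => f (Function.update x i 0)) ≠ 0) :
    NonvanishingOnUpper fun x => f (Function.update x i 0) := by
  refine nonvanishingOnUpper_of_im_mul_conj_nonpos (hf.comp_update i 0) (hf.slopeIn i).neg hi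
    ?_ ?_
  · intro x hx
    have hx0 (k : ι) : 0 ≤ (Function.update x i 0 k).im := by
      rcases eq_or_ne k i with rfl | hki
      · simp
      · simpa [hki] using (hx k).le
    have hle := hs.im_slopeIn_mul_conj_nonpos hf hx0 i
    rw [slopeIn_update] at hle
    simp only [Complex.mul_im, Complex.conj_re, Complex.conj_im, Pi.neg_apply, map_neg,
      Complex.neg_re, Complex.neg_im] at hle ⊢
    linarith
  · intro x hx hzero hslope
    refine hs x hx ?_
    have happly := hf i x (x i)
    rw [Function.update_eq_self] at happly
    rw [happly, hzero, neg_eq_zero.1 hslope, mul_zero, add_zero]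

theorem slopeIn_add_slopeIn [Finite ι] (hs : NonvanishingOnUpper f) (hf : MultiAffine f)
    {u : ι} (hu : NonvanishingOnUpper (slopeIn u f)) (v : ι) :
    NonvanishingOnUpper (slopeIn u f + slopeIn v f) := by
  intro x hx hzero
  have hneg := hs.im_slopeIn_mul_conj_neg hf hx (hu x hx)
  have hnonpos := hs.im_slopeIn_mul_conj_nonpos hf (fun k => (hx k).le) v
  have hsum : ((slopeIn u f + slopeIn v f) x * conj (f x)).im < 0 := by
    rw [Pi.add_apply, add_mul, Complex.add_im]
    linarith
  simp [hzero] at hsum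

end NonvanishingOnUpper

end Stability

section Rayleigh

open ComplexConjugate

variable {ι : Type*} [DecidableEq ι]

theorem ofReal_update (x : ι → ℝ) (i : ι) (t : ℝ) :
    (fun k => ((Function.update x i t k : ℝ) : ℂ)) =
      Function.update (fun k => (x k : ℂ)) i (t : ℂ) :=
  Function.comp_update Complex.ofReal x i t

/-- `f` is a multi-affine extension of the real function `F` to complex arguments. -/
structure IsComplexification (f : (ι → ℂ) → ℂ) (F : (ι → ℝ) → ℝ) : Prop where
  multiAffine : MultiAffine f
  ofReal : ∀ x : ι → ℝ, f (fun i => (x i : ℂ)) = F x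

/-- A multi-affine function satisfying the Rayleigh inequalities, that is, the correlation
inequalities of a stable polynomial. -/
structure IsRayleigh (F : (ι → ℝ) → ℝ) : Prop where
  multiAffine : MultiAffine F
  rayleigh : ∀ i j x, F x * slopeIn i (slopeIn j F) x ≤ slopeIn i F x * slopeIn j F x

namespace IsComplexification

variable {f g : (ι → ℂ) → ℂ} {F G : (ι → ℝ) → ℝ}

protected theorem add (hf : IsComplexification f F) (hg : IsComplexification g G) :
    IsComplexification (f + g) (F + G) where
  multiAffine := hf.multiAffine.add hg.multiAffine
  ofReal x := by simp [hf.ofReal, hg.ofReal]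

protected theorem slopeIn (hf : IsComplexification f F) (i : ι) :
    IsComplexification (slopeIn i f) (slopeIn i F) where
  multiAffine := hf.multiAffine.slopeIn i
  ofReal x := by
    rw [slopeIn_apply, slopeIn_apply, Complex.ofReal_sub, ← hf.ofReal, ← hf.ofReal,
      ofReal_update, ofReal_update, Complex.ofReal_one, Complex.ofReal_zero]

theorem ne_zero [Finite ι] (hf : IsComplexification f F) (h : f ≠ 0) : F ≠ 0 := by
  rintro rfl
  refine h (hf.multiAffine.eq_zero_of_forall_mem_pi (s := fun _ => Set.range Complex.ofReal)
    (fun _ => ⟨0, ⟨0, by simp⟩, 1, ⟨1, by simp⟩, zero_ne_one⟩) fun x hx => ?_)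
  choose y hy using fun i => hx i trivial
  rw [← funext hy, hf.ofReal, Pi.zero_apply, Complex.ofReal_zero]

theorem real_multiAffine (hf : IsComplexification f F) : MultiAffine F := by
  intro i x t
  have h := hf.multiAffine i (fun k => x k) t
  rw [← Complex.ofReal_zero, ← ofReal_update, ← ofReal_update, hf.ofReal, hf.ofReal,
    (hf.slopeIn i).ofReal] at h
  exact_mod_cast h

/-- The Rayleigh inequality is the inequality `Im (slopeIn i f * conj f) ≤ 0` at the point with
real coordinates except for an added `I` in the `j`-th one. -/
theorem isRayleigh [Finite ι] (hf : IsComplexification f F) (hs : NonvanishingOnUpper f) :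
    IsRayleigh F where
  multiAffine := hf.real_multiAffine
  rayleigh i j x := by
    have hx (k : ι) : 0 ≤ (Function.update (fun k => (x k : ℂ)) j (x j + Complex.I) k).im := by
      rcases eq_or_ne k j with rfl | hkj
      · simp
      · simp [hkj]
    have him := hs.im_slopeIn_mul_conj_nonpos hf.multiAffine hx i
    rw [(hf.multiAffine.slopeIn i).apply_update_add, hf.multiAffine.apply_update_add,
      slopeIn_comm j i, hf.ofReal, (hf.slopeIn i).ofReal, (hf.slopeIn j).ofReal,
      ((hf.slopeIn j).slopeIn i).ofReal] at him
    simp only [map_add, Complex.conj_ofReal, map_mul, Complex.conj_I, neg_mul, Complex.mul_im,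
      Complex.add_re, Complex.ofReal_re, Complex.mul_re, Complex.I_re, zero_mul, Complex.I_im,
      Complex.ofReal_im, mul_zero, sub_self, add_zero, Complex.add_im, Complex.neg_im, one_mul,
      zero_add, mul_neg, Complex.neg_re, neg_zero, neg_add_le_iff_le_add] at him
    linarith

end IsComplexification

section Barrier

variable {F : (ι → ℝ) → ℝ} {X Y : ι → ℝ}

theorem MultiAffine.slopeIn_nonneg (hF : MultiAffine F) (hnonneg : ∀ Y, X ≤ Y → 0 ≤ F Y) (i : ι)
    (hY : X ≤ Y) : 0 ≤ slopeIn i F Y := by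
  by_contra! h
  set s := (F Y + 1) / (-slopeIn i F Y)
  have hs : 0 ≤ s := div_nonneg (by linarith [hnonneg Y hY]) (by linarith)
  have hfar := hnonneg (Function.update Y i (Y i + s))
    (hY.trans (le_update_iff.2 ⟨by linarith, fun _ _ => le_rfl⟩))
  rw [hF.apply_update_add] at hfar
  have hsmul : s * -slopeIn i F Y = F Y + 1 := div_mul_cancel₀ _ (by linarith)
  linarith

/-- Moving the `v`-th variable down by `1 / (a + b)` costs a fraction `b / (a + b)` of `F`, which
leaves the fraction `a / (a + b)`. -/
theorem MultiAffine.pos_and_mul_slopeIn_le_of_update (hF : MultiAffine F)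
    (hpos : ∀ Y, X ≤ Y → 0 < F Y) (hY : X ≤ Y) {a b : ℝ} (ha : 0 < a) (hb : 0 < b) {u v : ι}
    (hu : slopeIn u F Y ≤ a * F Y) (hv : slopeIn v F Y ≤ b * F Y) :
    0 < F (Function.update Y v (Y v - 1 / (a + b))) ∧
      1 / (a + b) * slopeIn u F (Function.update Y v (Y v - 1 / (a + b))) ≤
        F (Function.update Y v (Y v - 1 / (a + b))) := by
  set t := 1 / (a + b)
  have ht : 0 < t := by positivity
  have htab : t * (a * F Y) + t * (b * F Y) = F Y := by
    have : t * (a + b) = 1 := one_div_mul_cancel (by positivity)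
    linear_combination F Y * this
  have huv : 0 ≤ slopeIn v (slopeIn u F) Y :=
    (hF.slopeIn u).slopeIn_nonneg
      (fun Z hZ => hF.slopeIn_nonneg (fun W hW => (hpos W hW).le) u hZ) v hY
  rw [sub_eq_add_neg, hF.apply_update_add, (hF.slopeIn u).apply_update_add]
  have hta : 0 < t * (a * F Y) := mul_pos ht (mul_pos ha (hpos Y hY))
  have htu := mul_le_mul_of_nonneg_left hu ht.le
  have htv := mul_le_mul_of_nonneg_left hv ht.le
  have htuv := mul_nonneg ht.le (mul_nonneg ht.le huv)
  constructor <;> linarith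

namespace IsRayleigh

theorem slopeIn_le_of_le [Finite ι] (hF : IsRayleigh F) (hpos : ∀ Y, X ≤ Y → 0 < F Y) {k : ι}
    {c : ℝ} (hX : slopeIn k F X ≤ c * F X) (hY : X ≤ Y) : slopeIn k F Y ≤ c * F Y := by
  cases nonempty_fintype ι
  suffices H : ∀ T : Finset ι, slopeIn k F (T.piecewise Y X) ≤ c * F (T.piecewise Y X) by
    simpa using H Finset.univ
  intro T
  induction T using Finset.induction_on with
  | empty => simpa using hX
  | insert i T hi ih =>
    set Z := T.piecewise Y X
    have hXZ : X ≤ Z := Finset.le_piecewise_of_le_of_le T hY le_rfl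
    have hstep : 0 ≤ Y i - Z i := by simpa [Z, hi] using hY i
    have hslope := hF.multiAffine.slopeIn_nonneg (fun W hW => (hpos W hW).le) i hXZ
    have hsecond : slopeIn i (slopeIn k F) Z ≤ c * slopeIn i F Z := by
      refine le_of_mul_le_mul_left ?_ (hpos Z hXZ)
      calc F Z * slopeIn i (slopeIn k F) Z
        _ ≤ slopeIn i F Z * slopeIn k F Z := hF.rayleigh i k Z
        _ ≤ slopeIn i F Z * (c * F Z) := mul_le_mul_of_nonneg_left ih hslope
        _ = F Z * (c * slopeIn i F Z) := by ring
    rw [Finset.piecewise_insert, hF.multiAffine.apply_update,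
      (hF.multiAffine.slopeIn k).apply_update]
    linarith [mul_le_mul_of_nonneg_left hsecond hstep]

theorem slopeIn_pos [Finite ι] (hF : IsRayleigh F) (hpos : ∀ Y, X ≤ Y → 0 < F Y) {k : ι}
    (hk : slopeIn k F ≠ 0) (hY : X ≤ Y) : 0 < slopeIn k F Y := by
  have hnonneg {Z : ι → ℝ} (hZ : X ≤ Z) :=
    hF.multiAffine.slopeIn_nonneg (fun W hW => (hpos W hW).le) k hZ
  refine (hnonneg hY).lt_of_ne' fun hzero => hk ?_
  refine (hF.multiAffine.slopeIn k).eq_zero_of_forall_mem_pi (s := fun i => Set.Ici (Y i))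
    (fun i => ⟨Y i, by simp, Y i + 1, by simp, by simp⟩) fun Z hZ => ?_
  have hYZ : Y ≤ Z := fun i => hZ i trivial
  refine le_antisymm ?_ (hnonneg (hY.trans hYZ))
  simpa using hF.slopeIn_le_of_le (c := 0) (fun W hW => hpos W (hY.trans hW)) (by simp [hzero]) hYZ

theorem slopeIn_slopeIn_add_slopeIn_le (hF : IsRayleigh F) {u v k : ι} {c t : ℝ} (ht : 0 ≤ t)
    (hpos : 0 < F Y) (hv : 0 ≤ slopeIn v F Y) (huv : 0 < (slopeIn u F + slopeIn v F) Y)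
    (hu : t * slopeIn u F Y ≤ F Y)
    (hk : slopeIn k F (Function.update Y v (Y v + t)) ≤ c * F (Function.update Y v (Y v + t))) :
    slopeIn k (slopeIn u F + slopeIn v F) Y ≤ c * (slopeIn u F + slopeIn v F) Y := by
  rw [hF.multiAffine.apply_update_add, (hF.multiAffine.slopeIn k).apply_update_add] at hk
  have hku := hF.rayleigh u k Y
  have hkv := hF.rayleigh v k Y
  rw [map_add, slopeIn_comm k u, slopeIn_comm k v]
  simp only [Pi.add_apply] at huv ⊢
  have hlift : 0 < F Y + t * slopeIn v F Y := by positivity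
  have hscaled : 0 ≤ F Y * ((slopeIn u F Y + slopeIn v F Y) *
      (slopeIn k F Y + t * slopeIn v (slopeIn k F) Y) -
      (slopeIn u (slopeIn k F) Y + slopeIn v (slopeIn k F) Y) * (F Y + t * slopeIn v F Y)) := by
    linarith [mul_nonneg (sub_nonneg.2 hku) hlift.le,
      mul_nonneg (sub_nonneg.2 hkv) (sub_nonneg.2 hu)]
  refine le_of_mul_le_mul_right (a := F Y + t * slopeIn v F Y) ?_ hlift
  linarith [nonneg_of_mul_nonneg_right hscaled hpos, mul_le_mul_of_nonneg_left hk huv.le]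

end IsRayleigh

end Barrier

end Rayleigh

/-! ### Paired derivatives -/

section PairDerivative

variable {κ R : Type*} [DecidableEq κ] [CommRing R]

/-- The operator `∂/∂z_i + ∂/∂w_i` on functions of two groups of variables `z` and `w`, indexed by
the left and by the right summand of `κ ⊕ κ`. -/
def pairDeriv (i : κ) : Module.End R ((κ ⊕ κ → R) → R) :=
  slopeIn (Sum.inl i) + slopeIn (Sum.inr i)

theorem pairDeriv_apply (i : κ) (f : (κ ⊕ κ → R) → R) :
    pairDeriv i f = slopeIn (Sum.inl i) f + slopeIn (Sum.inr i) f :=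
  rfl

theorem commute_pairDeriv_slopeIn (i : κ) (k : κ ⊕ κ) :
    Commute (pairDeriv (R := R) i) (slopeIn k) :=
  (commute_slopeIn _ _).add_left (commute_slopeIn _ _)

theorem commute_pairDeriv (i j : κ) : Commute (pairDeriv (R := R) i) (pairDeriv j) :=
  (commute_pairDeriv_slopeIn i _).add_right (commute_pairDeriv_slopeIn i _)

/-- The product of the operators `∂/∂z_i + ∂/∂w_i` over a finite set of indices. -/
def pairDerivs (s : Finset κ) : Module.End R ((κ ⊕ κ → R) → R) :=
  s.noncommProd pairDeriv fun i _ j _ _ => commute_pairDeriv i j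

theorem pairDerivs_empty (f : (κ ⊕ κ → R) → R) : pairDerivs ∅ f = f :=
  DFunLike.congr_fun (Finset.noncommProd_empty pairDeriv _) f

theorem pairDerivs_insert {i : κ} {s : Finset κ} (hi : i ∉ s) (f : (κ ⊕ κ → R) → R) :
    pairDerivs (insert i s) f = pairDerivs s (pairDeriv i f) :=
  DFunLike.congr_fun (Finset.noncommProd_insert_of_notMem' s i pairDeriv _ hi) f

theorem pairDerivs_insert' {i : κ} {s : Finset κ} (hi : i ∉ s) (f : (κ ⊕ κ → R) → R) :
    pairDerivs (insert i s) f = pairDeriv i (pairDerivs s f) :=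
  DFunLike.congr_fun (Finset.noncommProd_insert_of_notMem s i pairDeriv _ hi) f

protected theorem MultiAffine.pairDeriv {f : (κ ⊕ κ → R) → R} (hf : MultiAffine f) (i : κ) :
    MultiAffine (pairDeriv i f) :=
  (hf.slopeIn _).add (hf.slopeIn _)

protected theorem MultiAffine.pairDerivs {f : (κ ⊕ κ → R) → R} (hf : MultiAffine f)
    (s : Finset κ) : MultiAffine (pairDerivs s f) := by
  induction s using Finset.induction_on with
  | empty => rwa [pairDerivs_empty]
  | insert i s hi ih =>
    rw [pairDerivs_insert' hi]
    exact ih.pairDeriv i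

theorem slopeIn_inl_pairDeriv (i : κ) (f : (κ ⊕ κ → R) → R) :
    slopeIn (Sum.inl i) (pairDeriv i f) = slopeIn (Sum.inr i) (pairDeriv i f) := by
  rw [pairDeriv_apply, map_add, map_add, slopeIn_slopeIn_self, slopeIn_slopeIn_self, zero_add,
    add_zero, slopeIn_comm]

theorem MultiAffine.pairDeriv_update_update {f : (κ ⊕ κ → R) → R} (hf : MultiAffine f) (i : κ)
    (x : κ ⊕ κ → R) (t : R) :
    pairDeriv i f (Function.update (Function.update x (Sum.inl i) (x (Sum.inl i) + t)) (Sum.inr i)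
      (x (Sum.inr i) - t)) = pairDeriv i f x := by
  rw [(hf.pairDeriv i).apply_update, ← slopeIn_inl_pairDeriv, slopeIn_update,
    (hf.pairDeriv i).apply_update_add, Function.update_of_ne Sum.inr_ne_inl]
  ring

theorem MultiAffine.pairDerivs_univ_elim [Fintype κ] {f : (κ ⊕ κ → R) → R} (hf : MultiAffine f)
    (z w : κ → R) :
    pairDerivs Finset.univ f (Sum.elim z w) = pairDerivs Finset.univ f (Sum.elim (z + w) 0) := by
  suffices H : ∀ T : Finset κ, pairDerivs Finset.univ f (Sum.elim z w) =
      pairDerivs Finset.univ f (Sum.elim (T.piecewise (z + w) z) (T.piecewise 0 w)) by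
    simpa using H Finset.univ
  intro T
  induction T using Finset.induction_on with
  | empty => simp
  | insert i T hi ih =>
    have hsplit : pairDerivs Finset.univ f = pairDeriv i (pairDerivs (Finset.univ.erase i) f) := by
      rw [← pairDerivs_insert' (Finset.notMem_erase i _),
        Finset.insert_erase (Finset.mem_univ i)]
    rw [ih, hsplit, ← (hf.pairDerivs _).pairDeriv_update_update i _ (w i)]
    simp only [Finset.piecewise_insert, Finset.piecewise_eq_of_notMem _ _ _ hi, Sum.elim_inl,
      Sum.elim_inr, Sum.update_elim_inl, Sum.update_elim_inr, Pi.add_apply, Pi.zero_apply, sub_self]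

/-- The function `h(z) g(w)` of two groups of variables. -/
def tensorMul (h g : (κ → R) → R) : (κ ⊕ κ → R) → R :=
  fun x => h (x ∘ Sum.inl) * g (x ∘ Sum.inr)

theorem slopeIn_inl_tensorMul (i : κ) (h g : (κ → R) → R) :
    slopeIn (Sum.inl i) (tensorMul h g) = tensorMul (slopeIn i h) g := by
  funext x
  simp only [slopeIn_apply, tensorMul, Sum.update_inl_comp_inl, Sum.update_inl_comp_inr, sub_mul]

theorem slopeIn_inr_tensorMul (i : κ) (h g : (κ → R) → R) :
    slopeIn (Sum.inr i) (tensorMul h g) = tensorMul h (slopeIn i g) := by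
  funext x
  simp only [slopeIn_apply, tensorMul, Sum.update_inr_comp_inl, Sum.update_inr_comp_inr, mul_sub]

theorem pairDeriv_tensorMul (i : κ) (h g : (κ → R) → R) :
    pairDeriv i (tensorMul h g) = tensorMul (slopeIn i h) g + tensorMul h (slopeIn i g) := by
  rw [pairDeriv_apply, slopeIn_inl_tensorMul, slopeIn_inr_tensorMul]

theorem pairDerivs_tensorMul (s : Finset κ) (h g : (κ → R) → R) :
    pairDerivs s (tensorMul h g) =
      ∑ T ∈ s.powerset, tensorMul (slopesIn T h) (slopesIn (s \ T) g) := by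
  induction s using Finset.induction_on generalizing h g with
  | empty => simp [pairDerivs_empty, slopesIn_empty]
  | insert i s hi ih =>
    rw [pairDerivs_insert hi, pairDeriv_tensorMul, map_add, ih, ih,
      Finset.sum_powerset_insert hi, add_comm]
    congr 1 <;> refine Finset.sum_congr rfl fun T hT => ?_
    · have hiT : i ∉ T := fun h => hi (Finset.mem_powerset.1 hT h)
      rw [Finset.insert_sdiff_of_notMem _ hiT, slopesIn_insert (by simp [hi])]
    · have hiT : i ∉ T := fun h => hi (Finset.mem_powerset.1 hT h)
      rw [Finset.insert_sdiff_insert, Finset.sdiff_insert_of_notMem hi, slopesIn_insert hiT]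

theorem slopesIn_map_inl_tensorMul (T : Finset κ) (h g : (κ → R) → R) :
    slopesIn (T.map Function.Embedding.inl) (tensorMul h g) = tensorMul (slopesIn T h) g := by
  induction T using Finset.induction_on generalizing h with
  | empty => simp only [Finset.map_empty, slopesIn_empty]
  | insert i T hi ih =>
    rw [Finset.map_insert, slopesIn_insert (by simpa using hi), slopesIn_insert hi,
      Function.Embedding.inl_apply, slopeIn_inl_tensorMul, ih]

protected theorem MultiAffine.tensorMul {h g : (κ → R) → R} (hh : MultiAffine h)
    (hg : MultiAffine g) : MultiAffine (tensorMul h g) := by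
  rintro (i | i) x t
  · rw [slopeIn_inl_tensorMul]
    simp only [tensorMul, Sum.update_inl_comp_inl, Sum.update_inl_comp_inr]
    rw [hh i]
    ring
  · rw [slopeIn_inr_tensorMul]
    simp only [tensorMul, Sum.update_inr_comp_inl, Sum.update_inr_comp_inr]
    rw [hg i]
    ring

end PairDerivative

section StableChain

variable {κ : Type*} [DecidableEq κ] {f : (κ ⊕ κ → ℂ) → ℂ} {F : (κ ⊕ κ → ℝ) → ℝ} {s : Finset κ}
  {i : κ}

/-- Every partial derivative of `f` in distinct variables `z_i`, `i ∈ s`, is stable. -/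
def StableChain (s : Finset κ) (f : (κ ⊕ κ → ℂ) → ℂ) : Prop :=
  ∀ T ⊆ s, NonvanishingOnUpper (slopesIn (T.map Function.Embedding.inl) f)

namespace StableChain

theorem nonvanishing (hs : StableChain s f) : NonvanishingOnUpper f := by
  simpa only [Finset.map_empty, slopesIn_empty] using hs ∅ (Finset.empty_subset s)

theorem slopeIn_ne_zero (hs : StableChain s f) (hi : i ∈ s) : slopeIn (Sum.inl i) f ≠ 0 := by
  intro hzero
  have h := hs {i} (Finset.singleton_subset_iff.2 hi) (fun _ => Complex.I) (by simp)
  rw [Finset.map_singleton, ← insert_empty_eq, slopesIn_insert (Finset.notMem_empty _),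
    slopesIn_empty, Function.Embedding.inl_apply, hzero] at h
  exact h rfl

protected theorem pairDeriv [Finite κ] (hf : MultiAffine f) (hi : i ∉ s)
    (hs : StableChain (insert i s) f) : StableChain s (pairDeriv i f) := by
  intro T hT
  set D := slopesIn (R := ℂ) (T.map (Function.Embedding.inl (β := κ)))
  have hcomm (k : κ ⊕ κ) : D (slopeIn k f) = slopeIn k (D f) :=
    LinearMap.congr_fun
      (Finset.noncommProd_commute _ _ _ _ fun j _ => commute_slopeIn k j).symm f
  have hiT : i ∉ T := fun h => hi (hT h)
  have hinsert : NonvanishingOnUpper (slopeIn (Sum.inl i) (D f)) := by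
    have h := hs (insert i T) (Finset.insert_subset_insert i hT)
    rwa [Finset.map_insert, slopesIn_insert' (by simpa using hiT)] at h
  rw [pairDeriv_apply, map_add, hcomm, hcomm]
  exact (hs T (hT.trans (Finset.subset_insert i s))).slopeIn_add_slopeIn (hf.slopesIn _) hinsert _

protected theorem pairDerivs [Finite κ] (hf : MultiAffine f) (hs : StableChain s f) :
    NonvanishingOnUpper (pairDerivs s f) := by
  induction s using Finset.induction_on generalizing f with
  | empty =>
    rw [pairDerivs_empty]
    exact hs.nonvanishing
  | insert i s hi ih =>
    rw [pairDerivs_insert hi]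
    exact ih (hf.pairDeriv i) (hs.pairDeriv hf hi)

protected theorem tensorMul {h g : (κ → ℂ) → ℂ} (hh : ∀ T, NonvanishingOnUpper (slopesIn T h))
    (hg : NonvanishingOnUpper g) (s : Finset κ) : StableChain s (tensorMul h g) := by
  intro T _ x hx
  rw [slopesIn_map_inl_tensorMul]
  exact mul_ne_zero (hh T _ fun i => hx _) (hg _ fun i => hx _)

end StableChain

theorem IsComplexification.pairDeriv (hf : IsComplexification f F) (i : κ) :
    IsComplexification (pairDeriv i f) (pairDeriv i F) :=
  (hf.slopeIn _).add (hf.slopeIn _)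

theorem IsComplexification.pairDerivs (hf : IsComplexification f F) (s : Finset κ) :
    IsComplexification (pairDerivs s f) (pairDerivs s F) := by
  induction s using Finset.induction_on with
  | empty => rwa [pairDerivs_empty, pairDerivs_empty]
  | insert i s hi ih =>
    rw [pairDerivs_insert' hi, pairDerivs_insert' hi]
    exact ih.pairDeriv i

theorem IsComplexification.tensorMul {h g : (κ → ℂ) → ℂ} {H G : (κ → ℝ) → ℝ}
    (hh : IsComplexification h H) (hg : IsComplexification g G) :
    IsComplexification (tensorMul h g) (tensorMul H G) where
  multiAffine := hh.multiAffine.tensorMul hg.multiAffine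
  ofReal x := by
    rw [_root_.tensorMul, _root_.tensorMul, Complex.ofReal_mul, ← hh.ofReal, ← hg.ofReal]
    rfl

/-- The barrier condition: `F` is positive above `X`, and at `X` its logarithmic derivatives in the
variables `z_j` and `w_j`, for `j ∈ s`, are at most `a` and `b`. -/
structure Barrier (a b : ℝ) (s : Finset κ) (F : (κ ⊕ κ → ℝ) → ℝ) (X : κ ⊕ κ → ℝ) : Prop where
  pos : ∀ Y, X ≤ Y → 0 < F Y
  left : ∀ j ∈ s, slopeIn (Sum.inl j) F X ≤ a * F X
  right : ∀ j ∈ s, slopeIn (Sum.inr j) F X ≤ b * F X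

namespace Barrier

variable {a b : ℝ} {X : κ ⊕ κ → ℝ}

protected theorem pairDeriv [Finite κ] (hF : IsRayleigh F) (hi : slopeIn (Sum.inl i) F ≠ 0)
    (ha : 0 < a) (hb : 0 < b) (h : Barrier a b (insert i s) F X) :
    Barrier a b s (pairDeriv i F)
      (Function.update X (Sum.inr i) (X (Sum.inr i) - 1 / (a + b))) := by
  set t := 1 / (a + b) with ht
  set X' := Function.update X (Sum.inr i) (X (Sum.inr i) - t)
  have hlift {Y : κ ⊕ κ → ℝ} (hY : X' ≤ Y) :
      X ≤ Function.update Y (Sum.inr i) (Y (Sum.inr i) + t) := by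
    obtain ⟨hYi, hYk⟩ := update_le_iff.1 hY
    exact le_update_iff.2 ⟨by linarith, hYk⟩
  have hleft {Z : κ ⊕ κ → ℝ} (hZ : X ≤ Z) :=
    hF.slopeIn_le_of_le h.pos (h.left i (Finset.mem_insert_self i s)) hZ
  have hright {Z : κ ⊕ κ → ℝ} (hZ : X ≤ Z) :=
    hF.slopeIn_le_of_le h.pos (h.right i (Finset.mem_insert_self i s)) hZ
  have hbelow {Y : κ ⊕ κ → ℝ} (hY : X' ≤ Y) : 0 < F Y ∧ t * slopeIn (Sum.inl i) F Y ≤ F Y := by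
    simpa [← ht] using hF.multiAffine.pos_and_mul_slopeIn_le_of_update h.pos (hlift hY) ha hb
      (hleft (hlift hY)) (hright (hlift hY))
  have hinr {Y : κ ⊕ κ → ℝ} (hY : X' ≤ Y) : 0 ≤ slopeIn (Sum.inr i) F Y :=
    hF.multiAffine.slopeIn_nonneg (fun Z hZ => (hbelow hZ).1.le) _ hY
  have hpos {Y : κ ⊕ κ → ℝ} (hY : X' ≤ Y) : 0 < pairDeriv i F Y :=
    add_pos_of_pos_of_nonneg (hF.slopeIn_pos (fun Z hZ => (hbelow hZ).1) hi hY) (hinr hY)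
  have hbound {k : κ ⊕ κ} {c : ℝ} (hk : slopeIn k F X ≤ c * F X) :
      slopeIn k (pairDeriv i F) X' ≤ c * pairDeriv i F X' :=
    hF.slopeIn_slopeIn_add_slopeIn_le (by positivity) (hbelow le_rfl).1 (hinr le_rfl)
      (hpos le_rfl) (hbelow le_rfl).2 (by simpa [X'] using hk)
  exact
    { pos := fun Y hY => hpos hY
      left := fun j hj => hbound (h.left j (Finset.mem_insert_of_mem hj))
      right := fun j hj => hbound (h.right j (Finset.mem_insert_of_mem hj)) }

theorem pairDerivs_pos [Finite κ] (hf : IsComplexification f F) (hs : StableChain s f)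
    (ha : 0 < a) (hb : 0 < b) (h : Barrier a b s F X) {Y : κ ⊕ κ → ℝ}
    (hl : ∀ i, X (Sum.inl i) ≤ Y (Sum.inl i))
    (hr : ∀ i, X (Sum.inr i) - (if i ∈ s then 1 / (a + b) else 0) ≤ Y (Sum.inr i)) :
    0 < pairDerivs s F Y := by
  induction s using Finset.induction_on generalizing f F X with
  | empty =>
    rw [pairDerivs_empty]
    exact h.pos Y (Sum.rec hl fun i => by simpa using hr i)
  | insert i s hi ih =>
    rw [pairDerivs_insert hi]
    have hi0 := (hf.slopeIn (Sum.inl i)).ne_zero (hs.slopeIn_ne_zero (Finset.mem_insert_self i s))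
    refine ih (hf.pairDeriv i) (hs.pairDeriv hf.multiAffine hi)
      (h.pairDeriv (hf.isRayleigh hs.nonvanishing) hi0 ha hb) (by simpa using hl) fun j => ?_
    rcases eq_or_ne j i with rfl | hj
    · simpa [hi] using hr j
    · simpa [hj] using hr j

end Barrier

end StableChain

/-! ### Determinants and weights -/

section Determinant

variable {κ R : Type*} [DecidableEq κ] [CommRing R]

/-- The matrix `diag(z) - A` with the rows in `T` replaced by those of the identity matrix. -/
def borderedMatrix (A : Matrix κ κ R) (T : Finset κ) (z : κ → R) : Matrix κ κ R :=
  Matrix.of fun i => if i ∈ T then Pi.single i 1 else Pi.single i (z i) - A i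

theorem borderedMatrix_update (A : Matrix κ κ R) {T : Finset κ} {i : κ} (hi : i ∉ T)
    (z : κ → R) (t : R) : borderedMatrix A T (Function.update z i t) =
      (borderedMatrix A T z).updateRow i (t • Pi.single i 1 + -A i) := by
  ext j k
  rcases eq_or_ne j i with rfl | h
  · simp [borderedMatrix, hi, Pi.single_apply, sub_eq_add_neg]
  · simp [borderedMatrix, h]

theorem borderedMatrix_insert (A : Matrix κ κ R) (T : Finset κ) (i : κ) (z : κ → R) :
    borderedMatrix A (insert i T) z = (borderedMatrix A T z).updateRow i (Pi.single i 1) := by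
  ext j k
  rcases eq_or_ne j i with rfl | h
  · simp [borderedMatrix]
  · simp [borderedMatrix, h]

theorem borderedMatrix_empty (A : Matrix κ κ R) (z : κ → R) :
    borderedMatrix A ∅ z = Matrix.diagonal z - A := by
  ext i j
  rcases eq_or_ne i j with rfl | h
  · simp [borderedMatrix]
  · simp [borderedMatrix, h, h.symm]

variable [Fintype κ]

/-- The partial derivative of `det (diag(z) - A)` in the variables of `T`. -/
def borderedDet (A : Matrix κ κ R) (T : Finset κ) (z : κ → R) : R :=
  (borderedMatrix A T z).det

theorem borderedDet_empty (A : Matrix κ κ R) (z : κ → R) :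
    borderedDet A ∅ z = (Matrix.diagonal z - A).det := by
  rw [borderedDet, borderedMatrix_empty]

theorem borderedDet_update (A : Matrix κ κ R) {T : Finset κ} {i : κ} (hi : i ∉ T)
    (z : κ → R) (t : R) : borderedDet A T (Function.update z i t) =
      t * borderedDet A (insert i T) z + ((borderedMatrix A T z).updateRow i (-A i)).det := by
  rw [borderedDet, borderedMatrix_update A hi, Matrix.det_updateRow_add,
    Matrix.det_updateRow_smul, borderedDet, borderedMatrix_insert]

theorem slopeIn_borderedDet (A : Matrix κ κ R) {T : Finset κ} {i : κ} (hi : i ∉ T) :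
    slopeIn i (borderedDet A T) = borderedDet A (insert i T) := by
  funext z
  rw [slopeIn_apply, borderedDet_update A hi, borderedDet_update A hi]
  ring

theorem slopesIn_borderedDet (A : Matrix κ κ R) (T : Finset κ) :
    slopesIn T (borderedDet A ∅) = borderedDet A T := by
  induction T using Finset.induction_on with
  | empty => rw [slopesIn_empty]
  | insert i T hi ih => rw [slopesIn_insert' hi, ih, slopeIn_borderedDet A hi]

theorem multiAffine_borderedDet (A : Matrix κ κ R) : MultiAffine (borderedDet A ∅) := by
  intro i z t
  have hi := Finset.notMem_empty i
  rw [slopeIn_borderedDet A hi, borderedDet_update A hi, borderedDet_update A hi]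
  ring

theorem borderedDet_compl (A : Matrix κ κ R) (S : Finset κ) (x : R) :
    borderedDet A Sᶜ (fun _ => x) =
      (A.submatrix (Subtype.val : S → κ) Subtype.val).charpoly.eval x := by
  have hout : (borderedMatrix A Sᶜ fun _ => x).toSquareBlockProp (¬ · ∈ S) = 1 := by
    ext i j
    have hi : (i : κ) ∈ Sᶜ := Finset.mem_compl.2 i.2
    rw [Matrix.toSquareBlockProp_def, Matrix.of_apply, borderedMatrix, Matrix.of_apply, if_pos hi,
      Matrix.one_apply, Pi.single_apply]
    exact if_congr (by rw [Subtype.coe_inj, eq_comm]) rfl rfl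
  have hin : (borderedMatrix A Sᶜ fun _ => x).toSquareBlockProp (· ∈ S) =
      Matrix.scalar {i // i ∈ S} x - A.submatrix Subtype.val Subtype.val := by
    ext i j
    have hi : (i : κ) ∉ Sᶜ := fun h => Finset.mem_compl.1 h i.2
    rw [Matrix.toSquareBlockProp_def, Matrix.of_apply, borderedMatrix, Matrix.of_apply, if_neg hi,
      Pi.sub_apply, Pi.single_apply, Matrix.sub_apply, Matrix.scalar_apply, Matrix.diagonal_apply]
    exact congrArg (· - A i j) (if_congr (by rw [Subtype.coe_inj, eq_comm]) rfl rfl)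
  rw [Matrix.eval_charpoly, borderedDet,
    Matrix.twoBlockTriangular_det (borderedMatrix A Sᶜ fun _ => x) (· ∈ S), hout, hin,
    Matrix.det_one, mul_one]
  · convert rfl
  · intro i hi j hj
    have hji : j ≠ i := fun h => hi (h ▸ hj)
    simp [borderedMatrix, hi, hji]

end Determinant

section HermitianDeterminant

variable {κ : Type*} [DecidableEq κ] [Fintype κ] {A : Matrix κ κ ℂ}

theorem isComplexification_borderedDet (hA : A.IsHermitian) :
    IsComplexification (borderedDet A ∅) fun x => (borderedDet A ∅ fun i => (x i : ℂ)).re where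
  multiAffine := multiAffine_borderedDet A
  ofReal x := by
    have hM : (Matrix.diagonal (fun i => (x i : ℂ)) - A).IsHermitian :=
      (Matrix.isHermitian_diagonal_iff.2 fun i => Complex.conj_ofReal (x i)).sub hA
    refine (Complex.conj_eq_iff_re.1 ?_).symm
    rw [borderedDet_empty, ← Complex.star_def, ← Matrix.det_conjTranspose, hM.eq]

theorem nonvanishing_borderedDet (hA : A.IsHermitian) (T : Finset κ) :
    NonvanishingOnUpper (borderedDet A T) := by
  intro z hz hdet
  obtain ⟨v, hv, hMv⟩ := Matrix.exists_mulVec_eq_zero_iff.2 hdet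
  have hrow (i : κ) : star (v i) * (z i * v i) = star (v i) * A.mulVec v i := by
    have h : (if i ∈ T then Pi.single i 1 else Pi.single i (z i) - A i) ⬝ᵥ v = 0 :=
      congrFun hMv i
    by_cases hi : i ∈ T
    · rw [if_pos hi, single_dotProduct, one_mul] at h
      simp [h]
    · rw [if_neg hi, sub_dotProduct, single_dotProduct, sub_eq_zero] at h
      rw [h]
      rfl
  have him : ∑ i, (z i).im * Complex.normSq (v i) = 0 := by
    have hsum : star v ⬝ᵥ A.mulVec v = ∑ i, star (v i) * (z i * v i) :=
      Finset.sum_congr rfl fun i _ => (hrow i).symm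
    rw [← hA.im_star_dotProduct_mulVec_self v, hsum, RCLike.im_to_complex, Complex.im_sum]
    refine Finset.sum_congr rfl fun i _ => ?_
    rw [mul_left_comm, Complex.star_def, ← Complex.normSq_eq_conj_mul_self, Complex.im_mul_ofReal]
  rw [Finset.sum_eq_zero_iff_of_nonneg fun i _ =>
    mul_nonneg (hz i).le (Complex.normSq_nonneg (v i))] at him
  refine hv (funext fun i => Complex.normSq_eq_zero.1 ?_)
  exact (mul_eq_zero.1 (him i (Finset.mem_univ i))).resolve_left (hz i).ne'

end HermitianDeterminant

section WeightPoly

variable {κ R : Type*} [DecidableEq κ] [CommRing R]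

theorem prod_update (w : κ → R) (i : κ) (t : R) (S : Finset κ) :
    ∏ k ∈ S, Function.update w i t k =
      (if i ∈ S then t else 1) * ∏ k ∈ S.erase i, w k := by
  split_ifs with hi
  · rw [Finset.prod_update_of_mem hi, Finset.sdiff_singleton_eq_erase]
  · rw [Finset.prod_update_of_notMem hi, Finset.erase_eq_of_notMem hi, one_mul]

theorem slopeIn_prod (i : κ) (S : Finset κ) :
    slopeIn i (fun w : κ → R => ∏ k ∈ S, w k) =
      if i ∈ S then fun w : κ → R => ∏ k ∈ S.erase i, w k else 0 := by
  funext w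
  rw [slopeIn_apply, prod_update, prod_update]
  split_ifs <;> simp

theorem slopesIn_prod_zero (T S : Finset κ) :
    slopesIn T (fun w : κ → R => ∏ k ∈ S, w k) 0 = if S = T then 1 else 0 := by
  induction T using Finset.induction_on generalizing S with
  | empty => simp [slopesIn_empty, zero_pow_eq]
  | insert i T hi ih =>
    rw [slopesIn_insert hi, slopeIn_prod]
    split_ifs with hiS hST hST
    · rw [ih, if_pos ((Finset.erase_eq_iff_eq_insert hiS hi).2 hST)]
    · rw [ih, if_neg fun h => hST ((Finset.erase_eq_iff_eq_insert hiS hi).1 h)]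
    · exact absurd (hST ▸ Finset.mem_insert_self i T) hiS
    · rw [map_zero, Pi.zero_apply]

variable [Fintype κ] [Algebra ℝ R]

/-- The generating function `∑ S, m(S) w^S` of a real weight on the subsets of `κ`, evaluated in a
real algebra. -/
def weightPoly (m : Finset κ → ℝ) (w : κ → R) : R :=
  ∑ S, algebraMap ℝ R (m S) * ∏ i ∈ S, w i

theorem slopesIn_weightPoly_zero (m : Finset κ → ℝ) (T : Finset κ) :
    slopesIn T (weightPoly m) (0 : κ → R) = algebraMap ℝ R (m T) := by
  have hsum : (weightPoly m : (κ → R) → R) =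
      ∑ S, algebraMap ℝ R (m S) • fun w => ∏ i ∈ S, w i := by
    funext w
    simp only [weightPoly, Finset.sum_apply, Pi.smul_apply, smul_eq_mul]
  simp only [hsum, map_sum, map_smul, Finset.sum_apply, Pi.smul_apply, smul_eq_mul,
    slopesIn_prod_zero, mul_ite, mul_one, mul_zero, Finset.sum_ite_eq', Finset.mem_univ, if_true]

theorem multiAffine_weightPoly (m : Finset κ → ℝ) : MultiAffine (weightPoly (R := R) m) := by
  intro i x t
  simp only [weightPoly, slopeIn_apply, prod_update, ← Finset.sum_sub_distrib, Finset.mul_sum,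
    ← Finset.sum_add_distrib]
  refine Finset.sum_congr rfl fun S _ => ?_
  split_ifs <;> ring

theorem isComplexification_weightPoly (m : Finset κ → ℝ) :
    IsComplexification (weightPoly m : (κ → ℂ) → ℂ) (weightPoly m) where
  multiAffine := multiAffine_weightPoly m
  ofReal x := by simp [weightPoly]

theorem pairDerivs_tensorMul_borderedDet_weightPoly (A : Matrix κ κ R) (m : Finset κ → ℝ)
    (x y : R) :
    pairDerivs Finset.univ (tensorMul (borderedDet A ∅) (weightPoly m))
        (Sum.elim (fun _ => x) fun _ => y) =
      ∑ S : Finset κ, algebraMap ℝ R (m S) *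
        (A.submatrix (Subtype.val : S → κ) Subtype.val).charpoly.eval (x + y) := by
  rw [((multiAffine_borderedDet A).tensorMul (multiAffine_weightPoly m)).pairDerivs_univ_elim,
    pairDerivs_tensorMul, Finset.powerset_univ, Finset.sum_apply]
  refine Finset.sum_bij' (fun T _ => Tᶜ) (fun S _ => Sᶜ) (fun _ _ => Finset.mem_univ _)
    (fun _ _ => Finset.mem_univ _) (fun _ _ => compl_compl _) (fun _ _ => compl_compl _)
    fun T _ => ?_
  have hT : borderedDet A T (fun _ => x + y) = _ := compl_compl T ▸ borderedDet_compl A Tᶜ (x + y)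
  rw [← hT, ← slopesIn_weightPoly_zero, mul_comm, tensorMul, slopesIn_borderedDet,
    Finset.compl_eq_univ_sdiff]
  rfl

end WeightPoly

section MixedCharpoly

open Polynomial ComplexConjugate

/-- The characteristic polynomial of the principal submatrix `A(S)` of a hermitian matrix, as a
polynomial with real coefficients. -/
noncomputable def principalCharpoly {κ : Type*} [DecidableEq κ] {A : Matrix κ κ ℂ}
    (hA : A.IsHermitian) (S : Finset κ) : ℝ[X] :=
  ∏ i, (X - C ((hA.submatrix (Subtype.val : S → κ)).eigenvalues i))

theorem map_principalCharpoly {κ : Type*} [DecidableEq κ] {A : Matrix κ κ ℂ}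
    (hA : A.IsHermitian) (S : Finset κ) : (principalCharpoly hA S).map (algebraMap ℝ ℂ) =
      (A.submatrix (Subtype.val : S → κ) Subtype.val).charpoly := by
  simp only [principalCharpoly, (hA.submatrix (Subtype.val : S → κ)).charpoly_eq,
    Polynomial.map_prod, Polynomial.map_sub, map_X, map_C]

theorem natDegree_principalCharpoly {κ : Type*} [DecidableEq κ] {A : Matrix κ κ ℂ}
    (hA : A.IsHermitian) (S : Finset κ) :
    (principalCharpoly hA S).natDegree = S.card := by
  rw [principalCharpoly, natDegree_prod_of_monic _ _ fun _ _ => monic_X_sub_C _]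
  simp

theorem monic_principalCharpoly {κ : Type*} [DecidableEq κ] {A : Matrix κ κ ℂ}
    (hA : A.IsHermitian) (S : Finset κ) :
    (principalCharpoly hA S).Monic :=
  monic_prod_of_monic _ _ fun _ _ => monic_X_sub_C _

theorem eigenvalues_lt_of_eval_principalCharpoly_pos {κ : Type*} [DecidableEq κ] {A : Matrix κ κ ℂ}
    (hA : A.IsHermitian) {S : Finset κ} {c : ℝ}
    (h : ∀ x, c ≤ x → 0 < (principalCharpoly hA S).eval x) (i : S) :
    (hA.submatrix (Subtype.val : S → κ)).eigenvalues i < c := by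
  by_contra! hc
  refine (h _ hc).ne' ?_
  rw [principalCharpoly, eval_prod]
  exact Finset.prod_eq_zero (Finset.mem_univ i) (by simp)

/-- The mixture `∑ S, m(S) χ_S` of a family of polynomials, as a linear function of the weight. -/
noncomputable def mixture {κ : Type*} [Fintype κ] (χ : Finset κ → ℝ[X]) :
    (Finset κ → ℝ) →ₗ[ℝ] ℝ[X] :=
  Fintype.linearCombination ℝ χ

theorem mixture_apply {κ : Type*} [Fintype κ] (χ : Finset κ → ℝ[X]) (m : Finset κ → ℝ) :
    mixture χ m = ∑ S, m S • χ S := rfl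

variable {κ : Type*} [DecidableEq κ] [Fintype κ] {A : Matrix κ κ ℂ} {m : Finset κ → ℝ}

theorem aeval_mixture_principalCharpoly (hA : A.IsHermitian) (m : Finset κ → ℝ) (x y : ℂ) :
    aeval (x + y) (mixture (principalCharpoly hA) m) =
      pairDerivs Finset.univ (tensorMul (borderedDet A ∅) (weightPoly m))
        (Sum.elim (fun _ => x) fun _ => y) := by
  rw [pairDerivs_tensorMul_borderedDet_weightPoly, mixture_apply, map_sum]
  refine Finset.sum_congr rfl fun S _ => ?_
  rw [map_smul, Algebra.smul_def, aeval_def, ← eval_map, map_principalCharpoly]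

theorem stableChain_borderedDet_weightPoly (hA : A.IsHermitian)
    (hm : NonvanishingOnUpper (weightPoly m : (κ → ℂ) → ℂ)) :
    StableChain Finset.univ (tensorMul (borderedDet A ∅) (weightPoly m)) :=
  StableChain.tensorMul
    (fun T => slopesIn_borderedDet A T ▸ nonvanishing_borderedDet hA T) hm Finset.univ

theorem splits_of_forall_aeval_ne_zero {p : ℝ[X]} (h : ∀ z : ℂ, 0 < z.im → aeval z p ≠ 0) :
    p.Splits := by
  refine Splits.of_splits_map_of_injective (algebraMap ℝ ℂ).injective (IsAlgClosed.splits _)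
    fun z hz => ?_
  have hroot : aeval z p = 0 := (mem_aroots'.1 hz).2
  refine ⟨z.re, Complex.ext rfl (le_antisymm ?_ ?_)⟩
  · by_contra! hlt
    refine h (conj z) (by simpa using hlt) ?_
    rw [aeval_conj, hroot, map_zero]
  · by_contra! hlt
    exact h z hlt hroot

theorem splits_mixture_principalCharpoly (hA : A.IsHermitian)
    (hm : NonvanishingOnUpper (weightPoly m : (κ → ℂ) → ℂ)) :
    (mixture (principalCharpoly hA) m).Splits := by
  refine splits_of_forall_aeval_ne_zero fun z hz => ?_
  rw [← add_halves z, aeval_mixture_principalCharpoly]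
  refine (stableChain_borderedDet_weightPoly hA hm).pairDerivs
    ((multiAffine_borderedDet A).tensorMul (multiAffine_weightPoly m)) _ ?_
  have hz2 : 0 < (z / 2).im := by rw [Complex.div_ofNat_im]; exact half_pos hz
  rintro (_ | _) <;> exact hz2

theorem eval_mixture_principalCharpoly_pos (hA : A.IsHermitian)
    (hm : NonvanishingOnUpper (weightPoly m : (κ → ℂ) → ℂ)) {H : (κ → ℝ) → ℝ}
    (hH : IsComplexification (borderedDet A ∅) H) {a b x y : ℝ} (ha : 0 < a) (hb : 0 < b)
    (hdet : ∀ z : κ → ℝ, (∀ i, x ≤ z i) → 0 < H z)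
    (hdet_le : ∀ i, slopeIn i H (fun _ => x) ≤ a * H fun _ => x)
    (hpoly : ∀ w : κ → ℝ, (∀ i, y ≤ w i) → 0 < weightPoly m w)
    (hpoly_le : ∀ i, slopeIn i (weightPoly m) (fun _ : κ => y) ≤ b * weightPoly m fun _ : κ => y)
    {s : ℝ} (hs : x + y - 1 / (a + b) ≤ s) : 0 < (mixture (principalCharpoly hA) m).eval s := by
  have hf := hH.tensorMul (isComplexification_weightPoly m)
  have hbarrier : Barrier a b Finset.univ (tensorMul H (weightPoly m))
      (Sum.elim (fun _ => x) fun _ => y) :=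
    { pos := fun Y hY => mul_pos (hdet _ fun i => hY (Sum.inl i)) (hpoly _ fun i => hY (Sum.inr i))
      left := fun i _ => by
        rw [slopeIn_inl_tensorMul, tensorMul, tensorMul, ← mul_assoc]
        exact mul_le_mul_of_nonneg_right (hdet_le i) (hpoly _ fun _ => le_rfl).le
      right := fun i _ => by
        rw [slopeIn_inr_tensorMul, tensorMul, tensorMul, mul_left_comm]
        exact mul_le_mul_of_nonneg_left (hpoly_le i) (hdet _ fun _ => le_rfl).le }
  have hpos := hbarrier.pairDerivs_pos hf (stableChain_borderedDet_weightPoly hA hm) ha hb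
    (Y := Sum.elim (fun _ => x) fun _ => s - x) (fun _ => le_rfl)
    fun i => by
      simp only [if_pos (Finset.mem_univ i), Sum.elim_inr]
      linarith
  have hcast : (fun i => ((Sum.elim (fun _ => x) (fun _ => s - x) i : ℝ) : ℂ)) =
      (Sum.elim (fun _ => (x : ℂ)) fun _ => (s : ℂ) - x : κ ⊕ κ → ℂ) := by
    funext i
    rcases i with _ | _
    · rfl
    · exact Complex.ofReal_sub s x
  have heval : aeval (s : ℂ) (mixture (principalCharpoly hA) m) =
      ((mixture (principalCharpoly hA) m).eval s : ℝ) :=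
    aeval_algebraMap_apply_eq_algebraMap_eval s _
  rw [← Complex.zero_lt_real, ← (hf.pairDerivs Finset.univ).ofReal, hcast,
    ← aeval_mixture_principalCharpoly hA, add_sub_cancel, heval] at hpos
  exact Complex.zero_lt_real.1 hpos

end MixedCharpoly

/-! ### Interlacing polynomials -/

section Interlacing

open Polynomial

variable {K : Type*} [Field K] [LinearOrder K] [IsStrictOrderedRing K]

theorem coeff_prod_X_sub_C_pos {s : Multiset K} (hs : ∀ r ∈ s, r < 0) {k : ℕ}
    (hk : k ≤ Multiset.card s) : 0 < (s.map fun r => X - C r).prod.coeff k := by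
  induction s using Multiset.induction generalizing k with
  | empty => simp [Nat.le_zero.1 hk]
  | cons r s ih =>
    have hr := hs r (Multiset.mem_cons_self r s)
    replace ih {j : ℕ} := ih (fun x hx => hs x (Multiset.mem_cons_of_mem hx)) (k := j)
    rw [Multiset.map_cons, Multiset.prod_cons]
    rw [Multiset.card_cons] at hk
    rcases k with _ | k
    · rw [mul_coeff_zero, coeff_sub, coeff_X_zero, coeff_C_zero, zero_sub]
      exact mul_pos (neg_pos.2 hr) (ih (Nat.zero_le _))
    · rw [coeff_X_sub_C_mul, sub_eq_add_neg, ← neg_mul]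
      refine add_pos_of_pos_of_nonneg (ih (by omega)) (mul_nonneg (neg_nonneg.2 hr.le) ?_)
      rcases le_or_gt (k + 1) (Multiset.card s) with h | h
      · exact (ih h).le
      · rw [coeff_eq_zero_of_natDegree_lt (by rwa [natDegree_multiset_prod_X_sub_C_eq_card])]

theorem coeff_pos_of_splits {p : K[X]} (hp : p.Splits) (hlead : 0 < p.leadingCoeff)
    (hpos : ∀ x, 0 ≤ x → 0 < p.eval x) {k : ℕ} (hk : k ≤ p.natDegree) : 0 < p.coeff k := by
  rw [hp.eq_prod_roots, coeff_C_mul]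
  refine mul_pos hlead (coeff_prod_X_sub_C_pos (fun r hr => ?_) ?_)
  · by_contra! hr0
    exact (hpos r hr0).ne' (isRoot_of_mem_roots hr)
  · rwa [← hp.natDegree_eq_card_roots]

theorem eval_pos_of_coeff_nonneg {p : K[X]} (h : ∀ k, 0 ≤ p.coeff k) (h0 : 0 < p.coeff 0)
    {x : K} (hx : 0 ≤ x) : 0 < p.eval x := by
  rw [eval_eq_sum_range]
  refine Finset.sum_pos' (fun k _ => mul_nonneg (h k) (pow_nonneg hx k)) ⟨0, by simp, ?_⟩
  simpa using h0

theorem exists_mul_add_eq_zero_and_nonneg {ι : Type*} {s : Finset ι} {a b : ι → K}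
    (hab : ∀ i ∈ s, 0 < a i + b i) {i : ι} (hi : i ∈ s) (hbi : b i < 0) :
    ∃ t ∈ Set.Ioo 0 1, (∃ k ∈ s, t * a k + b k = 0) ∧ ∀ j ∈ s, 0 ≤ t * a j + b j := by
  have ha {j : ι} (hj : j ∈ s) (hbj : b j < 0) : 0 < a j := by linarith [hab j hj]
  obtain ⟨k, hk, hmax⟩ := (s.filter (b · < 0)).exists_max_image (fun j => -b j / a j)
    ⟨i, Finset.mem_filter.2 ⟨hi, hbi⟩⟩
  simp only [Finset.mem_filter] at hk hmax
  have hak := ha hk.1 hk.2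
  set t := -b k / a k
  have ht0 : 0 < t := div_pos (neg_pos.2 hk.2) hak
  have ht1 : t < 1 := by rw [div_lt_one hak]; linarith [hab k hk.1]
  have htk : t * a k = -b k := div_mul_cancel₀ _ hak.ne'
  refine ⟨t, ⟨ht0, ht1⟩, ⟨k, hk.1, by rw [htk, neg_add_cancel]⟩, fun j hj => ?_⟩
  rcases lt_or_ge (b j) 0 with hbj | hbj
  · have h := hmax j ⟨hj, hbj⟩
    rw [div_le_iff₀ (ha hj hbj)] at h
    linarith
  · nlinarith [hab j hj]

theorem natDegree_smul_add {f g : K[X]} (hfg : f.natDegree = g.natDegree)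
    (hf : 0 < f.leadingCoeff) (hg : 0 < g.leadingCoeff) {s : K} (hs : 0 < s) :
    (s • f + g).natDegree = g.natDegree ∧ 0 < (s • f + g).leadingCoeff := by
  have hcoeff : 0 < (s • f + g).coeff g.natDegree := by
    rw [coeff_add, coeff_smul, smul_eq_mul, ← hfg, coeff_natDegree, hfg, coeff_natDegree]
    positivity
  have hdeg : (s • f + g).natDegree = g.natDegree :=
    le_antisymm (natDegree_add_le_of_degree_le ((natDegree_smul_le s f).trans hfg.le) le_rfl)
      (le_natDegree_of_ne_zero hcoeff.ne')
  exact ⟨hdeg, by rwa [leadingCoeff, hdeg]⟩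

theorem eval_pos_of_splits_smul_add {f g : K[X]} (hfg : f.natDegree = g.natDegree)
    (hf : 0 < f.leadingCoeff) (hg : 0 < g.leadingCoeff)
    (hsplits : ∀ s : K, 0 < s → (s • f + g).Splits)
    (hpos : ∀ x, 0 ≤ x → 0 < (f + g).eval x) (hg0 : 0 < g.eval 0) {x : K} (hx : 0 ≤ x) :
    0 < g.eval x := by
  have hcoeff {s : K} (hs : 0 < s) (h : ∀ x, 0 ≤ x → 0 < (s • f + g).eval x) {k : ℕ}
      (hk : k ≤ g.natDegree) : 0 < s * f.coeff k + g.coeff k := by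
    obtain ⟨hdeg, hlead⟩ := natDegree_smul_add hfg hf hg hs
    simpa using coeff_pos_of_splits (hsplits s hs) hlead h (hdeg ▸ hk)
  have hone {k : ℕ} (hk : k ≤ g.natDegree) : 0 < f.coeff k + g.coeff k := by
    simpa using hcoeff one_pos (by simpa using hpos) hk
  rw [← coeff_zero_eq_eval_zero] at hg0
  refine eval_pos_of_coeff_nonneg (fun k => ?_) hg0 hx
  by_contra! hneg
  have hk : k ≤ g.natDegree := le_natDegree_of_ne_zero hneg.ne
  obtain ⟨t, ⟨ht0, ht1⟩, ⟨j, hj, hzero⟩, hnonneg⟩ := exists_mul_add_eq_zero_and_nonneg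
    (s := Finset.Iic g.natDegree) (fun i hi => hone (Finset.mem_Iic.1 hi)) (Finset.mem_Iic.2 hk)
    hneg
  refine (hcoeff ht0 (fun y hy => eval_pos_of_coeff_nonneg (fun i => ?_) ?_ hy)
    (Finset.mem_Iic.1 hj)).ne' hzero
  · rw [coeff_add, coeff_smul, smul_eq_mul]
    rcases le_or_gt i g.natDegree with hi | hi
    · exact hnonneg i (Finset.mem_Iic.2 hi)
    · simp [coeff_eq_zero_of_natDegree_lt hi, coeff_eq_zero_of_natDegree_lt (hfg ▸ hi)]
  · rw [coeff_add, coeff_smul, smul_eq_mul]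
    nlinarith [hone (Nat.zero_le _)]

theorem forall_eval_pos_or_of_splits_smul_add_smul {f g : K[X]} (hfg : f.natDegree = g.natDegree)
    (hf : 0 < f.leadingCoeff) (hg : 0 < g.leadingCoeff)
    (hsplits : ∀ s t : K, 0 < s → 0 < t → (s • f + t • g).Splits) {c : K}
    (hpos : ∀ x, c ≤ x → 0 < (f + g).eval x) :
    (∀ x, c ≤ x → 0 < f.eval x) ∨ ∀ x, c ≤ x → 0 < g.eval x := by
  wlog hgc : 0 < g.eval c generalizing f g
  · refine (this hfg.symm hg hf (fun s t hs ht => ?_) (by rwa [add_comm]) ?_).symm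
    · rw [add_comm]
      exact hsplits t s ht hs
    · have h := hpos c le_rfl
      rw [eval_add] at h
      linarith
  refine Or.inr fun x hx => ?_
  have h := eval_pos_of_splits_smul_add (f := taylor c f) (g := taylor c g)
    (by simpa using hfg) (by simpa using hf) (by simpa using hg) (fun s hs => ?_)
    (fun y hy => ?_) (by rwa [taylor_eval, zero_add]) (sub_nonneg.2 hx)
  · rwa [taylor_eval, sub_add_cancel] at h
  · rw [← map_smul, ← map_add, taylor_apply]
    simpa using (hsplits s 1 hs one_pos).comp_X_add_C c
  · rw [← map_add, taylor_eval]
    exact hpos _ (by linarith)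

end Interlacing

section Conditioning

open Polynomial

variable {κ : Type*} [Fintype κ]

theorem weightPoly_zero {R : Type*} [CommRing R] [Algebra ℝ R] :
    (weightPoly 0 : (κ → R) → R) = 0 := by
  funext w
  simp [weightPoly]

theorem weightPoly_smul {R : Type*} [CommRing R] [Algebra ℝ R] (t : ℝ) (m : Finset κ → ℝ)
    (w : κ → R) : weightPoly (t • m) w = algebraMap ℝ R t * weightPoly m w := by
  simp only [weightPoly, Finset.mul_sum, Pi.smul_apply, smul_eq_mul, map_mul, mul_assoc]

theorem weightPoly_const {R : Type*} [CommRing R] [Algebra ℝ R] {d : ℕ}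
    {m : Finset κ → ℝ} (hm : ∀ S, m S ≠ 0 → S.card = d) (t : R) :
    weightPoly m (fun _ => t) = algebraMap ℝ R (∑ S, m S) * t ^ d := by
  rw [weightPoly, map_sum, Finset.sum_mul]
  refine Finset.sum_congr rfl fun S _ => ?_
  rw [Finset.prod_const]
  rcases eq_or_ne (m S) 0 with h | h
  · rw [h, map_zero, zero_mul, zero_mul]
  · rw [hm S h]

theorem weightPoly_pos {m : Finset κ → ℝ} (hm : 0 ≤ m) (hm0 : m ≠ 0) {w : κ → ℝ}
    (hw : ∀ i, 0 < w i) : 0 < weightPoly m w := by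
  obtain ⟨S, hS⟩ := Function.ne_iff.1 hm0
  have hprod (S : Finset κ) : 0 < ∏ i ∈ S, w i := Finset.prod_pos fun i _ => hw i
  exact Finset.sum_pos' (fun S _ => mul_nonneg (hm S) (hprod S).le)
    ⟨S, Finset.mem_univ S, mul_pos ((hm S).lt_of_ne' hS) (hprod S)⟩

/-- A nonnegative weight, supported on the sets with `d` elements, whose generating
function is stable: an unnormalized homogeneous strongly Rayleigh measure. -/
structure StableWeight (d : ℕ) (m : Finset κ → ℝ) : Prop where
  nonneg : 0 ≤ m
  card : ∀ S, m S ≠ 0 → S.card = d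
  stable : NonvanishingOnUpper (weightPoly m : (κ → ℂ) → ℂ)

namespace StableWeight

variable {d : ℕ} {m : Finset κ → ℝ}

theorem ne_zero (hm : StableWeight d m) : m ≠ 0 := by
  rintro rfl
  exact hm.stable (fun _ => Complex.I) (fun _ => one_pos) (congrFun weightPoly_zero _)

theorem sum_pos (hm : StableWeight d m) : 0 < ∑ S, m S :=
  (Fintype.sum_nonneg hm.nonneg).lt_of_ne' fun h =>
    hm.ne_zero ((Fintype.sum_eq_zero_iff_of_nonneg hm.nonneg).1 h)

theorem natDegree_mixture_and_leadingCoeff_pos (hm : StableWeight d m) {χ : Finset κ → ℝ[X]}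
    (hχ : ∀ S, (χ S).Monic) (hdeg : ∀ S, (χ S).natDegree = S.card) :
    (mixture χ m).natDegree = d ∧ 0 < (mixture χ m).leadingCoeff := by
  have hle : (mixture χ m).natDegree ≤ d := by
    rw [mixture_apply]
    refine natDegree_sum_le_of_forall_le _ _ fun S _ => ?_
    rcases eq_or_ne (m S) 0 with h | h
    · simp [h]
    · exact (natDegree_smul_le _ _).trans (by rw [hdeg, hm.card S h])
  have hcoeff : (mixture χ m).coeff d = ∑ S, m S := by
    rw [mixture_apply, finsetSum_coeff]
    refine Finset.sum_congr rfl fun S _ => ?_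
    rw [coeff_smul, smul_eq_mul]
    rcases eq_or_ne (m S) 0 with h | h
    · rw [h, zero_mul]
    · rw [← hm.card S h, ← hdeg S, (hχ S).coeff_natDegree, mul_one]
  have hd : (mixture χ m).natDegree = d :=
    natDegree_eq_of_le_of_coeff_ne_zero hle (hcoeff ▸ hm.sum_pos.ne')
  exact ⟨hd, by rw [leadingCoeff, hd, hcoeff]; exact hm.sum_pos⟩

end StableWeight

theorem weightPoly_smul_indicator_add_indicator_compl [DecidableEq κ] {R : Type*}
    [CommRing R] [Algebra ℝ R] (i : κ) (m : Finset κ → ℝ) (s : ℝ) (w : κ → R) :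
    weightPoly (s • {S | i ∈ S}.indicator m + {S | i ∈ S}ᶜ.indicator m) w =
      weightPoly m (Function.update w i (algebraMap ℝ R s * w i)) := by
  simp only [weightPoly, prod_update]
  refine Finset.sum_congr rfl fun S _ => ?_
  by_cases hi : i ∈ S
  · simp [hi, ← Finset.mul_prod_erase S _ hi]
    ring
  · simp [hi]

theorem weightPoly_indicator_compl [DecidableEq κ] {R : Type*} [CommRing R] [Algebra ℝ R]
    (i : κ) (m : Finset κ → ℝ) (w : κ → R) :
    weightPoly ({S | i ∈ S}ᶜ.indicator m) w = weightPoly m (Function.update w i 0) := by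
  simpa using weightPoly_smul_indicator_add_indicator_compl i m 0 w

theorem weightPoly_indicator [DecidableEq κ] {R : Type*} [CommRing R] [Algebra ℝ R] (i : κ)
    (m : Finset κ → ℝ) (w : κ → R) :
    weightPoly ({S | i ∈ S}.indicator m) w = w i * slopeIn i (weightPoly m) w := by
  simp only [weightPoly, slopeIn_apply, prod_update, ← Finset.sum_sub_distrib, Finset.mul_sum]
  refine Finset.sum_congr rfl fun S _ => ?_
  by_cases hi : i ∈ S
  · simp [hi, ← Finset.mul_prod_erase S _ hi]
    ring
  · simp [hi]

theorem weightPoly_injective :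
    Function.Injective (weightPoly : (Finset κ → ℝ) → (κ → ℂ) → ℂ) := fun m m' h =>
  funext fun S => Complex.ofReal_injective <| by
    classical
    simpa only [slopesIn_weightPoly_zero] using! congrFun (congrArg (slopesIn S) h) 0

namespace StableWeight

variable {d : ℕ} {m : Finset κ → ℝ}

protected theorem indicator (hm : StableWeight d m) (i : κ) (h : {S | i ∈ S}.indicator m ≠ 0) :
    StableWeight d ({S | i ∈ S}.indicator m) where
  nonneg := Set.indicator_nonneg fun S _ => hm.nonneg S
  card S hS := hm.card S (Set.indicator_apply_ne_zero.1 hS).2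
  stable w hw := by
    classical
    rw [weightPoly_indicator]
    refine mul_ne_zero (fun h0 => (hw i).ne' (by rw [h0, Complex.zero_im]))
      (hm.stable.slopeIn (multiAffine_weightPoly m) (fun h0 => h ?_) w hw)
    refine weightPoly_injective (funext fun w => ?_)
    rw [weightPoly_indicator, h0, weightPoly_zero, Pi.zero_apply, mul_zero]

protected theorem indicator_compl (hm : StableWeight d m) (i : κ)
    (h : {S | i ∈ S}ᶜ.indicator m ≠ 0) : StableWeight d ({S | i ∈ S}ᶜ.indicator m) where
  nonneg := Set.indicator_nonneg fun S _ => hm.nonneg S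
  card S hS := hm.card S (Set.indicator_apply_ne_zero.1 hS).2
  stable w hw := by
    classical
    rw [weightPoly_indicator_compl]
    refine hm.stable.update_zero (multiAffine_weightPoly m) (fun h0 => h ?_) w hw
    refine weightPoly_injective (funext fun w => ?_)
    rw [weightPoly_indicator_compl, weightPoly_zero]
    exact congrFun h0 w

theorem smul_indicator_add_smul_indicator_compl (hm : StableWeight d m) (i : κ) {s t : ℝ}
    (hs : 0 < s) (ht : 0 < t) :
    StableWeight d (s • {S | i ∈ S}.indicator m + t • {S | i ∈ S}ᶜ.indicator m) where
  nonneg := add_nonneg (smul_nonneg hs.le (Set.indicator_nonneg fun S _ => hm.nonneg S))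
    (smul_nonneg ht.le (Set.indicator_nonneg fun S _ => hm.nonneg S))
  card S hS := hm.card S fun h0 => hS (by classical simp [Set.indicator_apply, h0])
  stable w hw := by
    classical
    have hsplit : s • {S | i ∈ S}.indicator m + t • {S | i ∈ S}ᶜ.indicator m =
        t • ((s / t) • {S | i ∈ S}.indicator m + {S | i ∈ S}ᶜ.indicator m) := by
      rw [smul_add, smul_smul, mul_div_cancel₀ _ ht.ne']
    rw [hsplit, weightPoly_smul, weightPoly_smul_indicator_add_indicator_compl]
    refine mul_ne_zero (Complex.ofReal_ne_zero.2 ht.ne') (hm.stable _ (upper_update hw i ?_))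
    rw [Complex.coe_algebraMap, Complex.im_ofReal_mul]
    exact mul_pos (div_pos hs ht) (hw i)

theorem exists_indicator_eval_pos (hm : StableWeight d m) {χ : Finset κ → ℝ[X]}
    (hχ : ∀ S, (χ S).Monic) (hdeg : ∀ S, (χ S).natDegree = S.card)
    (hsplits : ∀ m, StableWeight d m → (mixture χ m).Splits) {c : ℝ}
    (hpos : ∀ x, c ≤ x → 0 < (mixture χ m).eval x) (i : κ) :
    ∃ E : Set (Finset κ), (E = {S | i ∈ S} ∨ E = {S | i ∈ S}ᶜ) ∧ StableWeight d (E.indicator m) ∧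
      ∀ x, c ≤ x → 0 < (mixture χ (E.indicator m)).eval x := by
  have hadd : {S | i ∈ S}.indicator m + {S | i ∈ S}ᶜ.indicator m = m :=
    Set.indicator_self_add_compl _ m
  by_cases hin : {S | i ∈ S}.indicator m = 0
  · refine ⟨_, Or.inr rfl, ?_⟩
    rw [hin, zero_add] at hadd
    rw [hadd]
    exact ⟨hm, hpos⟩
  by_cases hout : {S | i ∈ S}ᶜ.indicator m = 0
  · refine ⟨_, Or.inl rfl, ?_⟩
    rw [hout, add_zero] at hadd
    rw [hadd]
    exact ⟨hm, hpos⟩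
  have hf := hm.indicator i hin
  have hg := hm.indicator_compl i hout
  obtain ⟨hfd, hfc⟩ := hf.natDegree_mixture_and_leadingCoeff_pos hχ hdeg
  obtain ⟨hgd, hgc⟩ := hg.natDegree_mixture_and_leadingCoeff_pos hχ hdeg
  rcases forall_eval_pos_or_of_splits_smul_add_smul (hfd.trans hgd.symm) hfc hgc
    (fun s t hs ht => by
      simpa only [map_add, map_smul] using
        hsplits _ (hm.smul_indicator_add_smul_indicator_compl i hs ht))
    (fun x hx => by rw [← map_add, hadd]; exact hpos x hx) with h | h
  · exact ⟨_, Or.inl rfl, hf, h⟩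
  · exact ⟨_, Or.inr rfl, hg, h⟩

theorem exists_pos_forall_eval_pos {χ : Finset κ → ℝ[X]}
    (hχ : ∀ S, (χ S).Monic) (hdeg : ∀ S, (χ S).natDegree = S.card)
    (hsplits : ∀ m, StableWeight d m → (mixture χ m).Splits) {c : ℝ}
    (hm : StableWeight d m) (hpos : ∀ x, c ≤ x → 0 < (mixture χ m).eval x) :
    ∃ S, 0 < m S ∧ ∀ x, c ≤ x → 0 < (χ S).eval x := by
  induction hN : (Function.support m).ncard using Nat.strong_induction_on generalizing m with
  | _ N ih =>
  obtain ⟨S, hS⟩ := Function.ne_iff.1 hm.ne_zero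
  have hSpos : 0 < m S := (hm.nonneg S).lt_of_ne' hS
  by_cases hT : ∃ T, m T ≠ 0 ∧ T ≠ S
  · obtain ⟨T, hT, hTS⟩ := hT
    have hcard : S.card = T.card := (hm.card S hS).trans (hm.card T hT).symm
    obtain ⟨i, hiS, hiT⟩ := Finset.not_subset.1 fun h =>
      hTS (Finset.eq_of_subset_of_card_le h hcard.ge).symm
    obtain ⟨E, hE, hmE, hposE⟩ := hm.exists_indicator_eval_pos hχ hdeg hsplits hpos i
    have hlt : (Function.support (E.indicator m)).ncard < N := by
      rw [← hN, Set.support_indicator]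
      refine Set.ncard_lt_ncard (Set.inter_subset_right.ssubset_of_not_subset fun h => ?_)
      rcases hE with rfl | rfl
      · exact hiT (h hT).1
      · exact (h hS).1 hiS
    obtain ⟨S', hS', hS'pos⟩ := ih _ hlt hmE hposE rfl
    exact ⟨S', hS'.trans_le (Set.indicator_le_self' (fun S _ => hm.nonneg S) S'), hS'pos⟩
  · push Not at hT
    refine ⟨S, hSpos, fun x hx => ?_⟩
    have hmix : mixture χ m = m S • χ S :=
      Fintype.sum_eq_single S fun T hTS => by rw [of_not_not (mt (hT T) hTS), zero_smul]
    have h := hpos x hx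
    rw [hmix, eval_smul, smul_eq_mul] at h
    exact pos_of_mul_pos_right h hSpos.le

end StableWeight

end Conditioning

/-! ### The resolvent of a positive contraction -/

section Resolvent

open scoped MatrixOrder

variable {κ 𝕜 : Type*} [DecidableEq κ] [RCLike 𝕜] {A : Matrix κ κ 𝕜}

theorem posDef_diagonal_sub (hA : A ≤ 1) {z : κ → ℝ} (hz : ∀ i, 1 < z i) :
    (Matrix.diagonal (fun i => (z i : 𝕜)) - A).PosDef := by
  have hdiag : (Matrix.diagonal fun i => ((z i - 1 : ℝ) : 𝕜)).PosDef :=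
    Matrix.PosDef.diagonal fun i => RCLike.ofReal_pos.2 (sub_pos.2 (hz i))
  have hsplit : Matrix.diagonal (fun i => (z i : 𝕜)) - A =
      Matrix.diagonal (fun i => ((z i - 1 : ℝ) : 𝕜)) + (1 - A) := by
    simp only [RCLike.ofReal_sub, RCLike.ofReal_one, ← Matrix.diagonal_sub, Matrix.diagonal_one]
    abel
  exact hsplit ▸ hdiag.add_posSemidef hA

variable [Fintype κ]

/-- The right-hand side is the chord of `t ↦ (x - t)⁻¹` over `[0, 1]`. -/
theorem inv_smul_one_sub_le (hA0 : 0 ≤ A) (hA1 : A ≤ 1) {x : ℝ} (hx : 1 < x) :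
    (x • (1 : Matrix κ κ 𝕜) - A)⁻¹ ≤ (x * (x - 1))⁻¹ • ((x - 1) • (1 : Matrix κ κ 𝕜) + A) := by
  set M := x • (1 : Matrix κ κ 𝕜) - A with hM
  have hMpos : M.PosDef := by
    have h := posDef_diagonal_sub hA1 (z := fun _ => x) fun _ => hx
    rwa [← Matrix.smul_one_eq_diagonal, ← RCLike.real_smul_eq_coe_smul] at h
  have hk : x * (x - 1) ≠ 0 := (mul_pos (by linarith) (by linarith)).ne'
  have hprod : M * ((x - 1) • 1 + A) = (x * (x - 1)) • 1 + A * (1 - A) := by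
    simp only [hM, sub_mul, mul_add, smul_mul_assoc, mul_smul_comm, mul_one, one_mul, mul_sub]
    module
  have hdiff : (x * (x - 1))⁻¹ • ((x - 1) • (1 : Matrix κ κ 𝕜) + A) - M⁻¹ =
      (x * (x - 1))⁻¹ • (M⁻¹ * (A * (1 - A))) := by
    rw [eq_sub_of_add_eq' hprod.symm, mul_sub (M⁻¹), ← mul_assoc,
      Matrix.nonsing_inv_mul _ ((Matrix.isUnit_iff_isUnit_det M).1 hMpos.isUnit), one_mul,
      smul_sub, mul_smul_comm, mul_one, inv_smul_smul₀ hk]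
  have hcomm : Commute A (1 - A) := (Commute.one_right A).sub_right (Commute.refl A)
  have hcommM : Commute M (A * (1 - A)) := by
    have h : Commute M A := ((Commute.one_left A).smul_left x).sub_left (Commute.refl A)
    exact h.mul_right ((Commute.one_right M).sub_right h)
  have hcommInv : Commute M⁻¹ (A * (1 - A)) := by
    obtain ⟨u, hu⟩ := hMpos.isUnit
    rw [← hu] at hcommM ⊢
    rw [← Matrix.coe_units_inv]
    exact hcommM.units_inv_left
  rw [← sub_nonneg, hdiff]
  exact smul_nonneg (inv_nonneg.2 (mul_nonneg (by linarith) (by linarith)))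
    (Commute.mul_nonneg hMpos.inv.posSemidef.nonneg
      (Commute.mul_nonneg hA0 (sub_nonneg.2 hA1) hcomm) hcommInv)

end Resolvent

section Thresholds

open scoped MatrixOrder

variable {κ : Type*} [DecidableEq κ] [Fintype κ] {A : Matrix κ κ ℂ} {H : (κ → ℝ) → ℝ}
  {m : Finset κ → ℝ}

theorem pos_of_isComplexification_borderedDet (hH : IsComplexification (borderedDet A ∅) H)
    (hA : A ≤ 1) {z : κ → ℝ} (hz : ∀ i, 1 < z i) : 0 < H z := by
  have h := (posDef_diagonal_sub hA hz).det_pos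
  rw [← borderedDet_empty] at h
  exact Complex.zero_lt_real.1 (hH.ofReal z ▸ h)

theorem slopeIn_le_of_isComplexification_borderedDet
    (hH : IsComplexification (borderedDet A ∅) H) (hA0 : 0 ≤ A) (hA1 : A ≤ 1) {x α : ℝ}
    (hx : 1 < x) {i : κ} (hα : (A i i).re ≤ α) :
    slopeIn i H (fun _ => x) ≤ (x - 1 + α) / (x * (x - 1)) * H fun _ => x := by
  set M := x • (1 : Matrix κ κ ℂ) - A with hM
  have hMdiag : borderedMatrix A ∅ (fun _ => (x : ℂ)) = M := by
    rw [borderedMatrix_empty, ← Matrix.smul_one_eq_diagonal, hM, ← Complex.coe_smul]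
  have hpos : 0 < H fun _ => x := pos_of_isComplexification_borderedDet hH hA1 fun _ => hx
  have hdet : M.det = (H fun _ => x : ℝ) := by rw [← hH.ofReal, borderedDet, hMdiag]
  have hunit : IsUnit M.det := by
    rw [hdet, isUnit_iff_ne_zero, Complex.ofReal_ne_zero]
    exact hpos.ne'
  have hslope : ((slopeIn i H fun _ => x : ℝ) : ℂ) = (H fun _ => x : ℝ) * M⁻¹ i i := by
    rw [← (hH.slopeIn i).ofReal, slopeIn_borderedDet A (Finset.notMem_empty i), borderedDet,
      borderedMatrix_insert, hMdiag, ← Matrix.adjugate_apply, Matrix.inv_def, Matrix.smul_apply,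
      smul_eq_mul, ← mul_assoc, ← hdet, Ring.mul_inverse_cancel _ hunit, one_mul]
  have hentry : (M⁻¹ i i).re ≤ (x - 1 + α) / (x * (x - 1)) := by
    have hchord := (Matrix.le_iff.1 (inv_smul_one_sub_le hA0 hA1 hx)).diag_nonneg (i := i)
    simp only [Matrix.sub_apply, Matrix.smul_apply, Matrix.add_apply, Matrix.one_apply_eq,
      sub_nonneg] at hchord
    have hre := (Complex.le_def.1 hchord).1
    rw [Complex.smul_re, Complex.add_re, Complex.smul_re, Complex.one_re, smul_eq_mul,
      smul_eq_mul, mul_one, inv_mul_eq_div] at hre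
    exact hre.trans (by
      have : 0 < x * (x - 1) := mul_pos (by linarith) (by linarith)
      gcongr)
  have hre := congrArg Complex.re hslope
  rw [Complex.ofReal_re, Complex.re_ofReal_mul, mul_comm] at hre
  exact hre.trans_le (mul_le_mul_of_nonneg_right hentry hpos.le)

theorem slopeIn_weightPoly_le {d : ℕ} (hm : ∀ S, m S ≠ 0 → S.card = d) {i : κ} {ε y : ℝ}
    (hy : 0 < y) (hε : ∑ S, {S | i ∈ S}.indicator m S ≤ ε * ∑ S, m S) :
    slopeIn i (weightPoly m) (fun _ => y) ≤ ε / y * weightPoly m fun _ => y := by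
  have hslope := weightPoly_indicator i m fun _ => y
  rw [weightPoly_const fun S hS => hm S (Set.indicator_apply_ne_zero.1 hS).2] at hslope
  rw [weightPoly_const hm, div_mul_eq_mul_div, le_div_iff₀ hy, mul_comm, ← hslope, ← mul_assoc]
  exact mul_le_mul_of_nonneg_right hε (pow_nonneg hy.le d)

theorem StableWeight.exists_eigenvalues_lt {d : ℕ} (hm : StableWeight d m) (hA : A.PosSemidef)
    (hA1 : A ≤ 1) {α δ x : ℝ} (hdiag : ∀ i, (A i i).re ≤ α) (hδ0 : 0 < δ)
    (hδ1 : δ < 1) (hmarg : ∀ i, ∑ S, {S | i ∈ S}.indicator m S ≤ δ ^ 2 * ∑ S, m S)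
    (hx : 1 < x) (hα : 0 < x - 1 + α) : ∃ S, 0 < m S ∧
      ∀ i, (hA.isHermitian.submatrix (Subtype.val : S → κ)).eigenvalues i <
        x - (1 - δ) ^ 2 * (x * (x - 1) / (x - 1 + α)) := by
  set a := (x - 1 + α) / (x * (x - 1)) with ha
  have ha0 : 0 < a := div_pos hα (mul_pos (by linarith) (by linarith))
  have hδ : 0 < 1 - δ := by linarith
  -- This `b` minimizes the threshold `x + δ ^ 2 / b - 1 / (a + b)`.
  set b := δ * a / (1 - δ) with hb
  have hb0 : 0 < b := by positivity
  have hy : 0 < δ ^ 2 / b := by positivity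
  have hthreshold : x + δ ^ 2 / b - 1 / (a + b) =
      x - (1 - δ) ^ 2 * (x * (x - 1) / (x - 1 + α)) := by
    have hab : a + b = a / (1 - δ) := by
      rw [hb]
      field_simp
      ring
    rw [hab, hb, ← inv_div (x - 1 + α), ← ha]
    field_simp
    ring
  have hH := isComplexification_borderedDet hA.isHermitian
  obtain ⟨S, hS, hSpos⟩ := hm.exists_pos_forall_eval_pos (monic_principalCharpoly hA.isHermitian)
    (natDegree_principalCharpoly hA.isHermitian)
    (fun m hm => splits_mixture_principalCharpoly hA.isHermitian hm.stable)
    fun s hs => eval_mixture_principalCharpoly_pos hA.isHermitian hm.stable hH ha0 hb0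
      (fun z hz => pos_of_isComplexification_borderedDet hH hA1 fun i => hx.trans_le (hz i))
      (fun i => slopeIn_le_of_isComplexification_borderedDet hH hA.nonneg hA1 hx (hdiag i))
      (fun w hw => weightPoly_pos hm.nonneg hm.ne_zero fun i => hy.trans_le (hw i))
      (fun i => by
        have h := slopeIn_weightPoly_le hm.card hy (hmarg i)
        rwa [div_div_cancel₀ (pow_ne_zero 2 hδ0.ne')] at h)
      (hthreshold.trans_le hs)
  exact ⟨S, hS, eigenvalues_lt_of_eval_principalCharpoly_pos hA.isHermitian hSpos⟩

end Thresholds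

section LargestEigenvalue

open scoped MatrixOrder Matrix.Norms.L2Operator

theorem lambdaMax_lt_coe_iff {ι : Type*} [Fintype ι] [DecidableEq ι] {M : Matrix ι ι ℂ}
    (hM : M.IsHermitian) {c : ℝ} : lambdaMax M < c ↔ ∀ i, hM.eigenvalues i < c := by
  rw [lambdaMax, hM.spectrum_real_eq_range_eigenvalues, iSup_range, ← Finset.sup_univ_eq_iSup,
    Finset.sup_lt_iff (EReal.bot_lt_coe c)]
  simp only [Finset.mem_univ, forall_const, EReal.coe_lt_coe_iff]

theorem lambdaMax_le_one {ι : Type*} [Fintype ι] [DecidableEq ι] {M : Matrix ι ι ℂ}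
    (hM : M.IsHermitian) (hM1 : M ≤ 1) : lambdaMax M ≤ 1 :=
  iSup₂_le fun r hr => by exact_mod_cast (CFC.le_one_iff M hM).1 hM1 r hr

theorem submatrix_le_one {κ ι : Type*} [DecidableEq κ] [DecidableEq ι]
    {A : Matrix κ κ ℂ} (hA : A ≤ 1) {f : ι → κ} (hf : Function.Injective f) :
    A.submatrix f f ≤ 1 := by
  rw [← Matrix.submatrix_one f hf]
  exact (Matrix.le_iff.1 hA).submatrix f

theorem le_one_of_isMatrixContraction {n : ℕ} {A : Matrix (Fin n) (Fin n) ℂ}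
    (hA0 : A.PosSemidef) (hA : IsMatrixContraction A) : A ≤ 1 :=
  (CStarAlgebra.norm_le_one_iff_of_nonneg A hA0.nonneg).1 hA

/-- The left-hand side is the threshold of `StableWeight.exists_eigenvalues_lt` for `δ = e ^ 2`
at `x = e⁻¹ + 1 - α`. -/
theorem threshold_lt {e α : ℝ} (he : 0 < e) (hα : 0 ≤ α) (hle : 4 * e + α ≤ 1) :
    e⁻¹ + 1 - α - (1 - e ^ 2) ^ 2 * ((e⁻¹ + 1 - α) * (e⁻¹ + 1 - α - 1) / (e⁻¹ + 1 - α - 1 + α)) <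
      4 * e + α := by
  have hgap : 4 * e + α - (e⁻¹ + 1 - α -
      (1 - e ^ 2) ^ 2 * ((e⁻¹ + 1 - α) * (e⁻¹ + 1 - α - 1) / (e⁻¹ + 1 - α - 1 + α))) =
      e * (4 - (1 + (1 - 2 * α) * e) * (2 - e ^ 2) - (1 - e ^ 2) ^ 2 * (α * (1 - α))) := by
    rw [show e⁻¹ + 1 - α - 1 + α = e⁻¹ by ring]
    field_simp
    ring
  have hfirst : (1 + (1 - 2 * α) * e) * (2 - e ^ 2) ≤ 5 / 4 * 2 :=
    mul_le_mul (by nlinarith) (by nlinarith) (by nlinarith) (by norm_num)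
  have hsecond : (1 - e ^ 2) ^ 2 * (α * (1 - α)) ≤ 1 * (1 / 4) :=
    mul_le_mul (pow_le_one₀ (by nlinarith) (by nlinarith)) (by nlinarith [sq_nonneg (α - 1 / 2)])
      (mul_nonneg hα (by linarith)) zero_le_one
  rw [← sub_pos, hgap]
  exact mul_pos he (by linarith)

variable {κ : Type*} [Fintype κ] [DecidableEq κ] {d : ℕ} {m : Finset κ → ℝ} {A : Matrix κ κ ℂ}

theorem StableWeight.exists_lambdaMax_lt (hm : StableWeight d m) (hA : A.PosSemidef)
    (hA1 : A ≤ 1) {ε α : ℝ} (hdiag : ∀ i, (A i i).re ≤ α)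
    (hmarg : ∀ i, ∑ S, {S | i ∈ S}.indicator m S ≤ ε * ∑ S, m S) :
    ∃ S, 0 < m S ∧ lambdaMax (A.submatrix (Subtype.val : S → κ) Subtype.val) <
      ((4 * ε ^ (1 / 4 : ℝ) + α : ℝ) : EReal) := by
  have hherm (S : Finset κ) := hA.isHermitian.submatrix (Subtype.val : S → κ)
  obtain ⟨S₀, hS₀⟩ := Function.ne_iff.1 hm.ne_zero
  have hS₀pos : 0 < m S₀ := (hm.nonneg S₀).lt_of_ne' hS₀
  rcases S₀.eq_empty_or_nonempty with rfl | ⟨i, hi⟩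
  · exact ⟨∅, hS₀pos, (lambdaMax_lt_coe_iff (hherm ∅)).2 isEmptyElim⟩
  have hα : 0 ≤ α := (Complex.nonneg_iff.1 (hA.diag_nonneg (i := i))).1.trans (hdiag i)
  have hε : 0 < ε := by
    refine pos_of_mul_pos_left (lt_of_lt_of_le ?_ (hmarg i)) hm.sum_pos.le
    exact Finset.sum_pos' (fun S _ => Set.indicator_nonneg (fun S _ => hm.nonneg S) S)
      ⟨S₀, Finset.mem_univ S₀, by
        rwa [Set.indicator_of_mem (show S₀ ∈ {S : Finset κ | i ∈ S} from hi)]⟩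
  set e := ε ^ (1 / 4 : ℝ) with he
  have he0 : 0 < e := Real.rpow_pos_of_pos hε _
  have he4 : (e ^ 2) ^ 2 = ε := by
    rw [← pow_mul, he, one_div]
    exact Real.rpow_inv_natCast_pow hε.le four_ne_zero
  rcases lt_or_ge 1 (4 * e + α) with hlarge | hsmall
  · exact ⟨S₀, hS₀pos, (lambdaMax_le_one (hherm S₀)
      (submatrix_le_one hA1 Subtype.val_injective)).trans_lt (by exact_mod_cast hlarge)⟩
  have he1 : e < 1 := by linarith
  have hinv : 1 < e⁻¹ := (one_lt_inv₀ he0).2 he1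
  obtain ⟨S, hS, hlt⟩ := hm.exists_eigenvalues_lt hA hA1 hdiag (pow_pos he0 2)
    (pow_lt_one₀ he0.le he1 two_ne_zero) (he4.symm ▸ hmarg) (x := e⁻¹ + 1 - α)
    (by linarith) (by linarith)
  exact ⟨S, hS, (lambdaMax_lt_coe_iff (hherm S)).2 fun i =>
    (hlt i).trans (threshold_lt he0 hα hsmall)⟩

end LargestEigenvalue

section Measure

variable {n : ℕ} {μ : PMF (Finset (Fin n))}

theorem weightPoly_toReal (μ : PMF (Finset (Fin n))) (w : Fin n → ℂ) :
    weightPoly (fun S => (μ S).toReal) w = MvPolynomial.aeval w (generatingPoly μ) := by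
  simp [weightPoly, generatingPoly]

theorem prob_eq_sum_indicator (μ : PMF (Finset (Fin n))) (E : Set (Finset (Fin n))) :
    prob μ E = ∑ S, E.indicator (fun S => (μ S).toReal) S := by
  rw [prob, PMF.toOuterMeasure_apply_fintype,
    ENNReal.toReal_sum fun S _ => ((Set.indicator_le_self E μ S).trans_lt (μ.apply_lt_top S)).ne]
  exact Finset.sum_congr rfl fun S _ =>
    (congrFun (Set.indicator_comp_of_zero ENNReal.toReal_zero) S).symm

theorem sum_toReal_eq_one (μ : PMF (Finset (Fin n))) : ∑ S, (μ S).toReal = 1 := by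
  rw [← ENNReal.toReal_sum fun S _ => μ.apply_ne_top S,
    ← tsum_fintype (L := .unconditional _), μ.tsum_coe, ENNReal.toReal_one]

theorem prob_pos_of_mem {E : Set (Finset (Fin n))} {S : Finset (Fin n)} (hSE : S ∈ E)
    (hS : 0 < (μ S).toReal) : 0 < prob μ E := by
  rw [prob_eq_sum_indicator]
  exact Finset.sum_pos' (fun T _ => Set.indicator_nonneg (fun _ _ => ENNReal.toReal_nonneg) T)
    ⟨S, Finset.mem_univ S, by rwa [Set.indicator_of_mem hSE]⟩

theorem sum_single_one_injective {κ : Type*} :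
    Function.Injective fun S : Finset κ => ∑ i ∈ S, Finsupp.single i 1 := fun S T h =>
  Finset.val_injective <| by simpa using congrArg Finsupp.toMultiset h

theorem coeff_generatingPoly (μ : PMF (Finset (Fin n))) (S : Finset (Fin n)) :
    (generatingPoly μ).coeff (∑ i ∈ S, Finsupp.single i 1) = (μ S).toReal := by
  have hprod (T : Finset (Fin n)) : (∏ i ∈ T, MvPolynomial.X i : MvPolynomial (Fin n) ℝ) =
      MvPolynomial.monomial (∑ i ∈ T, Finsupp.single i 1) 1 :=
    (MvPolynomial.monomial_sum_one T fun i => Finsupp.single i 1).symm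
  simp [generatingPoly, MvPolynomial.coeff_sum, hprod, MvPolynomial.coeff_C_mul,
    MvPolynomial.coeff_monomial, sum_single_one_injective.eq_iff]

theorem stableWeight_toReal {d : ℕ} (hd : (generatingPoly μ).IsHomogeneous d)
    (hSR : IsStronglyRayleigh μ) : StableWeight d fun S => (μ S).toReal where
  nonneg S := ENNReal.toReal_nonneg
  card S hS := by
    rw [← coeff_generatingPoly] at hS
    simpa [map_sum, Finsupp.weight_single] using hd hS
  stable w hw := by
    rw [weightPoly_toReal]
    exact hSR w hw

end Measure

theorem mainTheorem3_general (n : ℕ) (μ : PMF (Finset (Fin n))) (A : Matrix (Fin n) (Fin n) ℂ)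
    (ε α : ℝ) (hhom : IsHomogeneousMeasure μ) (hSR : IsStronglyRayleigh μ)
    (hmarg : ∀ i, marginal μ i ≤ ε) (hpsd : A.PosSemidef) (hcontr : IsMatrixContraction A)
    (hdiag : ∀ i, (A i i).re ≤ α) :
    0 < prob μ {S | lambdaMax (principalSubmatrix A S)
      < ((4 * ε ^ (1 / 4 : ℝ) + α : ℝ) : EReal)} := by
  obtain ⟨d, hd⟩ := hhom
  obtain ⟨S, hS, hlt⟩ := (stableWeight_toReal hd hSR).exists_lambdaMax_lt hpsd
    (le_one_of_isMatrixContraction hpsd hcontr) hdiag fun i => by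
      rw [sum_toReal_eq_one, mul_one, ← prob_eq_sum_indicator]
      exact hmarg i
  exact prob_pos_of_mem hlt hS

theorem mainTheorem3 (n : ℕ) (μ : PMF (Finset (Fin n))) (A : Matrix (Fin n) (Fin n) ℂ)
    (ε α : ℝ)
    (hhom : IsHomogeneousMeasure μ) (hSR : IsStronglyRayleigh μ)
    (hmarg : ∀ i, marginal μ i ≤ ε)
    (hpsd : A.PosSemidef) (hcontr : IsMatrixContraction A)
    (hdiag : ∀ i, (A i i).re ≤ α)
    (hαε : Real.sqrt α + Real.sqrt ε ≤ 1) :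
    0 < prob μ {S | lambdaMax (principalSubmatrix A S)
      < ((4 * ε ^ (1 / 4 : ℝ) + α : ℝ) : EReal)} :=
  mainTheorem3_general n μ A ε α hhom hSR hmarg hpsd hcontr hdiag
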